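/- **Setting.** Let $\alpha,\beta>-1$ and $d\mu(x)=(1-x)^{\alpha}(1+x)^{\beta}\,dx$ on $[-1,1]$. Let $N\ge 0$, let $c_1,\dots,c_N\in\mathbb R\setminus(-1,1)$ be distinct, $d_j\in\mathbb Z_{\ge 0}$, $\lambda_{j,k}\ge 0$ for $1\le j\le N$, $0\le k\le d_j$, and put $d=\sum_{j=1}^N(d_j+1)$. Let $S_n$ be the lowest degree monic polynomial with $\langle x^k,S_n\rangle_{\mathsf s}=0$ for $0\le k<n$, where $$\langle f,g\rangle_{\mathsf s}=\int_{-1}^1 f g\,d\mu+\sum_{j=1}^N\sum_{k=0}^{d_j}\lambda_{j,k}f^{(k)}(c_j)g^{(k)}(c_j).$$ Let $P_n$ be the corresponding monic Jacobi polynomial (the same definition with the inner product $\int fg\,d\mu$), and $h_n=\int_{-1}^1P_n^2\,d\mu$. Put $$\gamma_{1,n}=\tfrac{\beta^2-\alpha^2}{(2n+\alpha+\beta)(2n+\alpha+\beta+2)},\qquad \gamma_{2,n}=\tfrac{4n(n+\alpha)(n+\beta)(n+\alpha+\beta)}{(2n+\alpha+\beta)^2((2n+\alpha+\beta)^2-1)},$$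 $$\hat a_n(x)=-\tfrac{n((2n+\alpha+\beta)x+\beta-\alpha)}{2n+\alpha+\beta},\qquad \hat b_n=\tfrac{4n(n+\alpha)(n+\beta)(n+\alpha+\beta)}{(2n+\alpha+\beta)^2(2n+\alpha+\beta-1)},$$ $$\hat c_n(x)=\tfrac{(n+\alpha+\beta)((2n+\alpha+\beta)x+\alpha-\beta)}{2n+\alpha+\beta},\qquad \hat d_n=-(2n+\alpha+\beta-1),$$ where for $n=1$ the common factor $1+\alpha+\beta$ in $\gamma_{2,1}$ and $\hat b_1$ is cancelled, i.e. $\gamma_{2,1}=\frac{4(1+\alpha)(1+\beta)}{(2+\alpha+\beta)^2(3+\alpha+\beta)}$ and $\hat b_1=\frac{4(1+\alpha)(1+\beta)}{(2+\alpha+\beta)^2}$ (also when $\alpha+\beta=-1$). Let $Q_k(x,c;f)=\sum_{\nu=0}^k\frac{f^{(\nu)}(c)}{\nu!}(x-c)^\nu$, $\rho(x)=\prod_{j=1}^N(x-c_j)^{d_j+1}$, $\rho_{j,k}(x)=\rho(x)/(x-c_j)^{k+1}$. For $m\ge1$ define the polynomials $$A_{2,m}=\rho-\sum_{j=1}^N\sum_{k=0}^{d_j}\tfrac{k!\,\lambda_{j,k}S_m^{(k)}(c_j)}{h_{m-1}}Q_k(x,c_j;P_{m-1})\rho_{j,k},\qquad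 B_{2,m}=\sum_{j=1}^N\sum_{k=0}^{d_j}\tfrac{k!\,\lambda_{j,k}S_m^{(k)}(c_j)}{h_{m-1}}Q_k(x,c_j;P_m)\rho_{j,k},$$ $$A_{3,m}=(1-x^2)A_{2,m}'+\hat a_mA_{2,m}+\hat d_mB_{2,m},\qquad B_{3,m}=(1-x^2)B_{2,m}'+\hat b_mA_{2,m}+\hat c_mB_{2,m},$$ and for $n\ge2$ and $i\in\{2,3\}$ $$C_{i,n}=-\frac{B_{i,n-1}}{\gamma_{2,n-1}},\qquad D_{i,n}=A_{i,n-1}+B_{i,n-1}\,\frac{x-\gamma_{1,n-1}}{\gamma_{2,n-1}},\qquad \Delta_n=A_{2,n}D_{2,n}-C_{2,n}B_{2,n}.$$ **Theorem (ladder equations).** For every $n\ge2$, $\rho$ divides $\Delta_n$; let $\delta_n=\Delta_n/\rho$. The polynomials $$q_{0,n}=(1-x^2)\Delta_n,\qquad q_{1,n}=B_{3,n}A_{2,n}-A_{3,n}B_{2,n},$$ $$q_{2,n}=(1-x^2)\rho'\delta_n+B_{3,n}C_{2,n}-A_{3,n}D_{2,n},\qquad q_{3,n}=(1-x^2)\rho'\delta_n+C_{3,n}B_{2,n}-D_{3,n}A_{2,n},$$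 $$q_{4,n}=C_{3,n}D_{2,n}-D_{3,n}C_{2,n}$$ are nonzero and have exact degrees $2d+2$, $2d$, $2d+1$, $2d+1$ and $2d$ respectively, and with $$A_{4,n}=\frac{q_{2,n}}{q_{1,n}},\quad B_{4,n}=\frac{q_{0,n}}{q_{1,n}},\quad C_{4,n}=\frac{q_{3,n}}{q_{4,n}},\quad D_{4,n}=\frac{q_{0,n}}{q_{4,n}}$$ the ladder equations $$A_{4,n}S_n+B_{4,n}S_n'=S_{n-1},\qquad C_{4,n}S_{n-1}+D_{4,n}S_{n-1}'=S_n$$ hold as identities of rational functions. -/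

import Mathlib

open Polynomial

/-! ### Monic orthogonal polynomials of a form on real polynomials -/

/-- `p` is monic and `⟨x ^ k, p⟩ = 0` for `k = 0, …, n - 1`. -/
def IsMonicOrth (B : ℝ[X] → ℝ[X] → ℝ) (n : ℕ) (p : ℝ[X]) : Prop :=
  p.Monic ∧ ∀ k < n, B (X ^ k) p = 0

/-- `p` is a monic polynomial of lowest degree with `⟨x ^ k, p⟩ = 0` for `k = 0, …, n - 1`. -/
def IsLowestMonicOrth (B : ℝ[X] → ℝ[X] → ℝ) (n : ℕ) (p : ℝ[X]) : Prop :=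
  IsMonicOrth B n p ∧ ∀ q, IsMonicOrth B n q → p.natDegree ≤ q.natDegree

/-- For a form that is linear in its second variable there is exactly one monic polynomial of
lowest degree orthogonal to `1, x, …, x ^ (n - 1)`. -/
theorem existsUnique_isLowestMonicOrth (B : ℝ[X] → ℝ[X] → ℝ)
    (hadd : ∀ f g h, B f (g + h) = B f g + B f h)
    (hsmul : ∀ (a : ℝ) (f g : ℝ[X]), B f (C a * g) = a * B f g) (n : ℕ) :
    ∃! p, IsLowestMonicOrth B n p := by
  classical
  have hsc : ∀ q : ℝ[X], q ≠ 0 → (∀ k < n, B (X ^ k) q = 0) →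
      IsMonicOrth B n (C q.leadingCoeff⁻¹ * q) := by
    intro q hq h
    refine ⟨?_, fun k hk => by rw [hsmul, h k hk, mul_zero]⟩
    rw [mul_comm]
    exact monic_mul_leadingCoeff_inv hq
  have hex : ∃ p, IsMonicOrth B n p := by
    let φ : ℝ[X] →ₗ[ℝ] (Fin n → ℝ) :=
      { toFun := fun p k => B (X ^ (k : ℕ)) p
        map_add' := fun p q => by ext k; simp [hadd]
        map_smul' := fun a p => by ext k; simp [smul_eq_C_mul, hsmul] }
    let ψ : (Fin (n + 1) → ℝ) →ₗ[ℝ] (Fin n → ℝ) :=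
      φ ∘ₗ (degreeLT ℝ (n + 1)).subtype ∘ₗ (degreeLTEquiv ℝ (n + 1)).symm.toLinearMap
    have hker : LinearMap.ker ψ ≠ ⊥ := LinearMap.ker_ne_bot_of_finrank_lt (by simp)
    obtain ⟨v, hv, hv0⟩ := (Submodule.ne_bot_iff _).1 hker
    refine ⟨_, hsc ((degreeLTEquiv ℝ (n + 1)).symm v : ℝ[X]) ?_ ?_⟩
    · simpa using hv0
    · intro k hk
      have := congrFun (LinearMap.mem_ker.1 hv) ⟨k, hk⟩
      simpa [ψ, φ] using this
  have hmin : ∃ p, IsLowestMonicOrth B n p := by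
    have hP : ∃ m, ∃ p, IsMonicOrth B n p ∧ p.natDegree = m := by
      obtain ⟨p, hp⟩ := hex
      exact ⟨_, p, hp, rfl⟩
    obtain ⟨p, hp, hpd⟩ := Nat.find_spec hP
    exact ⟨p, hp, fun q hq => hpd ▸ Nat.find_min' hP ⟨q, hq, rfl⟩⟩
  obtain ⟨p, hp⟩ := hmin
  refine ⟨p, hp, fun q hq => ?_⟩
  by_contra hne
  have hdeg : q.natDegree = p.natDegree := le_antisymm (hq.2 p hp.1) (hp.2 q hq.1)
  have hsub : q - p ≠ 0 := sub_ne_zero.2 hne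
  have hlt : (q - p).degree < q.degree :=
    degree_sub_lt_left (by rw [degree_eq_natDegree hq.1.1.ne_zero, degree_eq_natDegree hp.1.1.ne_zero,
      hdeg]) hq.1.1.ne_zero (by rw [hq.1.1.leadingCoeff, hp.1.1.leadingCoeff])
  have horth : ∀ k < n, B (X ^ k) (q - p) = 0 := by
    intro k hk
    have : q - p = q + C (-1) * p := by simp [sub_eq_add_neg]
    rw [this, hadd, hsmul, hq.1.2 k hk, hp.1.2 k hk]
    simp
  have h1 := hq.2 _ (hsc _ hsub horth)
  have h2 : (C (q - p).leadingCoeff⁻¹ * (q - p)).natDegree = (q - p).natDegree :=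
    natDegree_C_mul (inv_ne_zero (leadingCoeff_ne_zero.2 hsub))
  have h3 := natDegree_lt_natDegree hsub hlt
  omega

/-- The lowest degree monic polynomial orthogonal to `1, x, …, x ^ (n - 1)`. -/
noncomputable def monicOrth (B : ℝ[X] → ℝ[X] → ℝ) (n : ℕ) : ℝ[X] :=
  Classical.epsilon (IsLowestMonicOrth B n)

/-! ### Jacobi polynomials -/

/-- The Jacobi inner product `∫_{-1}^{1} f g (1 - x)^α (1 + x)^β dx`. -/
noncomputable def jacobiInner (α β : ℝ) (f g : ℝ[X]) : ℝ :=
  ∫ x in (-1 : ℝ)..1, f.eval x * g.eval x * ((1 - x) ^ α * (1 + x) ^ β)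

theorem intervalIntegrable_jacobi {α β : ℝ} (hα : -1 < α) (hβ : -1 < β) (f : ℝ[X]) :
    IntervalIntegrable (fun x : ℝ => f.eval x * ((1 - x) ^ α * (1 + x) ^ β))
      MeasureTheory.volume (-1) 1 := by
  apply IntervalIntegrable.continuousOn_mul _ f.continuous.continuousOn
  have hleft : IntervalIntegrable (fun x : ℝ => (1 - x) ^ α * (1 + x) ^ β)
      MeasureTheory.volume (-1) 0 := by
    apply IntervalIntegrable.continuousOn_mul
    · have := (intervalIntegral.intervalIntegrable_rpow' (a := 0) (b := 1) hβ).comp_add_left 1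
      simpa using this
    · apply ContinuousOn.rpow_const (by fun_prop)
      intro x hx
      rw [Set.uIcc_of_le (by norm_num)] at hx
      left
      linarith [hx.2]
  have hright : IntervalIntegrable (fun x : ℝ => (1 - x) ^ α * (1 + x) ^ β)
      MeasureTheory.volume 0 1 := by
    apply IntervalIntegrable.mul_continuousOn
    · have := (intervalIntegral.intervalIntegrable_rpow' (a := 1) (b := 0) hα).comp_sub_left 1
      simpa using this
    · apply ContinuousOn.rpow_const (by fun_prop)
      intro x hx
      rw [Set.uIcc_of_le (by norm_num)] at hx
      left
      linarith [hx.1]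
  exact hleft.trans hright

theorem jacobiInner_add_right {α β : ℝ} (hα : -1 < α) (hβ : -1 < β) (f g h : ℝ[X]) :
    jacobiInner α β f (g + h) = jacobiInner α β f g + jacobiInner α β f h := by
  unfold jacobiInner
  have h1 := intervalIntegrable_jacobi hα hβ (f * g)
  have h2 := intervalIntegrable_jacobi hα hβ (f * h)
  simp only [eval_mul] at h1 h2
  rw [← intervalIntegral.integral_add h1 h2]
  congr 1
  ext x
  rw [eval_add]
  ring

theorem jacobiInner_smul_right (α β a : ℝ) (f g : ℝ[X]) :
    jacobiInner α β f (C a * g) = a * jacobiInner α β f g := by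
  unfold jacobiInner
  rw [← intervalIntegral.integral_const_mul]
  congr 1
  ext x
  rw [eval_mul, eval_C]
  ring

/-- The monic Jacobi polynomial `P_n^{α,β}`. -/
noncomputable def jacobiP (α β : ℝ) (n : ℕ) : ℝ[X] := monicOrth (jacobiInner α β) n

theorem jacobiP_spec {α β : ℝ} (hα : -1 < α) (hβ : -1 < β) (n : ℕ) :
    IsLowestMonicOrth (jacobiInner α β) n (jacobiP α β n) :=
  Classical.epsilon_spec (existsUnique_isLowestMonicOrth _ (jacobiInner_add_right hα hβ)
    (jacobiInner_smul_right α β) n).exists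

/-- `h_n = ‖P_n^{α,β}‖²`. -/
noncomputable def jacobiH (α β : ℝ) (n : ℕ) : ℝ :=
  jacobiInner α β (jacobiP α β n) (jacobiP α β n)

/-- The recurrence coefficient `γ_{1,n}` (used for `n ≥ 1`). -/
noncomputable def gamma1 (α β : ℝ) (n : ℕ) : ℝ :=
  (β ^ 2 - α ^ 2) / ((2 * n + α + β) * (2 * n + α + β + 2))

/-- The recurrence coefficient `γ_{2,n}` (used for `n ≥ 1`). For `n = 1` the common factor
`1 + α + β` of numerator and denominator is cancelled, so that the value is also correct
when `α + β = -1`. -/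
noncomputable def gamma2 (α β : ℝ) (n : ℕ) : ℝ :=
  if n = 1 then 4 * (1 + α) * (1 + β) / ((2 + α + β) ^ 2 * (3 + α + β))
  else 4 * n * (n + α) * (n + β) * (n + α + β) /
    ((2 * n + α + β) ^ 2 * ((2 * n + α + β) ^ 2 - 1))

/-- `â_n(x)`. -/
noncomputable def aHat (α β : ℝ) (n : ℕ) : ℝ[X] :=
  C (-(n : ℝ) / (2 * n + α + β)) * (C (2 * n + α + β) * X + C (β - α))

/-- `b̂_n`. For `n = 1` the common factor `1 + α + β` of numerator and denominator is
cancelled, so that the value is also correct when `α + β = -1`. -/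
noncomputable def bHat (α β : ℝ) (n : ℕ) : ℝ :=
  if n = 1 then 4 * (1 + α) * (1 + β) / (2 + α + β) ^ 2
  else 4 * n * (n + α) * (n + β) * (n + α + β) /
    ((2 * n + α + β) ^ 2 * (2 * n + α + β - 1))

/-- `ĉ_n(x)`. -/
noncomputable def cHat (α β : ℝ) (n : ℕ) : ℝ[X] :=
  C ((n + α + β) / (2 * n + α + β)) * (C (2 * n + α + β) * X + C (α - β))

/-- `d̂_n`. -/
noncomputable def dHat (α β : ℝ) (n : ℕ) : ℝ := -(2 * n + α + β - 1)

/-- The Taylor polynomial `Q_k(x, c; f)` of degree `k` of `f` centred at `c`. -/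
noncomputable def taylorQ (k : ℕ) (c : ℝ) (f : ℝ[X]) : ℝ[X] :=
  ∑ ν ∈ Finset.range (k + 1), C ((derivative^[ν] f).eval c / (ν.factorial : ℝ)) * (X - C c) ^ ν

/-! ### The Jacobi–Sobolev setting -/

/-- The data of a Jacobi–Sobolev inner product: the parameters of the Jacobi weight, the
distinct mass points `c j` outside `(-1, 1)`, the orders `ord j` (that is, `d_j`) and the
masses `lam j k ≥ 0` for `k ≤ ord j`. The values `lam j k` with `k > ord j` are never used. -/
structure JacobiSobolev where
  α : ℝ
  β : ℝ
  hα : -1 < α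
  hβ : -1 < β
  N : ℕ
  c : Fin N → ℝ
  c_injective : Function.Injective c
  c_notMem : ∀ j, c j ∉ Set.Ioo (-1 : ℝ) 1
  ord : Fin N → ℕ
  lam : Fin N → ℕ → ℝ
  lam_nonneg : ∀ j, ∀ k ≤ ord j, 0 ≤ lam j k

namespace JacobiSobolev

/-- The Jacobi–Sobolev inner product. -/
noncomputable def inner (J : JacobiSobolev) (f g : ℝ[X]) : ℝ :=
  jacobiInner J.α J.β f g + ∑ j : Fin J.N, ∑ k ∈ Finset.range (J.ord j + 1),
    J.lam j k * (derivative^[k] f).eval (J.c j) * (derivative^[k] g).eval (J.c j)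

/-- The monic Jacobi–Sobolev polynomial `S_n`. -/
noncomputable def S (J : JacobiSobolev) (n : ℕ) : ℝ[X] := monicOrth J.inner n

theorem S_spec (J : JacobiSobolev) (n : ℕ) : IsLowestMonicOrth J.inner n (J.S n) := by
  refine Classical.epsilon_spec (existsUnique_isLowestMonicOrth _ ?_ ?_ n).exists
  · intro f g h
    simp only [inner, jacobiInner_add_right J.hα J.hβ, iterate_map_add, eval_add, mul_add,
      Finset.sum_add_distrib]
    ring
  · intro a f g
    simp only [inner, jacobiInner_smul_right, iterate_derivative_C_mul, eval_mul, eval_C, mul_add,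
      Finset.mul_sum]
    congr 1
    refine Finset.sum_congr rfl fun j _ => Finset.sum_congr rfl fun k _ => ?_
    ring

/-- `d = ∑ (d_j + 1)`. -/
def d (J : JacobiSobolev) : ℕ := ∑ j : Fin J.N, (J.ord j + 1)

/-- `ρ(x) = ∏ (x - c_j)^(d_j + 1)`. -/
noncomputable def rho (J : JacobiSobolev) : ℝ[X] :=
  ∏ j : Fin J.N, (X - C (J.c j)) ^ (J.ord j + 1)

/-- `ρ_{j,k}(x) = ρ(x) / (x - c_j)^(k + 1)` for `k ≤ d_j`. -/
noncomputable def rhoJK (J : JacobiSobolev) (j : Fin J.N) (k : ℕ) : ℝ[X] :=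
  (X - C (J.c j)) ^ (J.ord j - k) *
    ∏ i ∈ Finset.univ.erase j, (X - C (J.c i)) ^ (J.ord i + 1)

/-- The number `k! λ_{j,k} S_n^{(k)}(c_j) / h_{n-1}` (used for `n ≥ 1`). It vanishes when
`λ_{j,k} = 0`, so the sums below over all `k ≤ d_j` are sums over the pairs with
`λ_{j,k} > 0`. -/
noncomputable def weight (J : JacobiSobolev) (n : ℕ) (j : Fin J.N) (k : ℕ) : ℝ :=
  (k.factorial : ℝ) * J.lam j k * (derivative^[k] (J.S n)).eval (J.c j) /
    jacobiH J.α J.β (n - 1)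

/-- `A_{2,n}`. -/
noncomputable def A2 (J : JacobiSobolev) (n : ℕ) : ℝ[X] :=
  J.rho - ∑ j : Fin J.N, ∑ k ∈ Finset.range (J.ord j + 1),
    C (J.weight n j k) * taylorQ k (J.c j) (jacobiP J.α J.β (n - 1)) * J.rhoJK j k

/-- `B_{2,n}`. -/
noncomputable def B2 (J : JacobiSobolev) (n : ℕ) : ℝ[X] :=
  ∑ j : Fin J.N, ∑ k ∈ Finset.range (J.ord j + 1),
    C (J.weight n j k) * taylorQ k (J.c j) (jacobiP J.α J.β n) * J.rhoJK j k

/-- `A_{3,n}`. -/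
noncomputable def A3 (J : JacobiSobolev) (n : ℕ) : ℝ[X] :=
  derivative (J.A2 n) * (1 - X ^ 2) + aHat J.α J.β n * J.A2 n + C (dHat J.α J.β n) * J.B2 n

/-- `B_{3,n}`. -/
noncomputable def B3 (J : JacobiSobolev) (n : ℕ) : ℝ[X] :=
  derivative (J.B2 n) * (1 - X ^ 2) + C (bHat J.α J.β n) * J.A2 n + cHat J.α J.β n * J.B2 n

/-- `(x - γ_{1,n-1}) / γ_{2,n-1}`. -/
noncomputable def recFactor (J : JacobiSobolev) (n : ℕ) : ℝ[X] :=
  C (gamma2 J.α J.β (n - 1))⁻¹ * (X - C (gamma1 J.α J.β (n - 1)))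

/-- `C_{2,n}` (used for `n ≥ 2`). -/
noncomputable def C2 (J : JacobiSobolev) (n : ℕ) : ℝ[X] :=
  -(C (gamma2 J.α J.β (n - 1))⁻¹ * J.B2 (n - 1))

/-- `D_{2,n}` (used for `n ≥ 2`). -/
noncomputable def D2 (J : JacobiSobolev) (n : ℕ) : ℝ[X] :=
  J.A2 (n - 1) + J.B2 (n - 1) * J.recFactor n

/-- `C_{3,n}` (used for `n ≥ 2`). -/
noncomputable def C3 (J : JacobiSobolev) (n : ℕ) : ℝ[X] :=
  -(C (gamma2 J.α J.β (n - 1))⁻¹ * J.B3 (n - 1))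

/-- `D_{3,n}` (used for `n ≥ 2`). -/
noncomputable def D3 (J : JacobiSobolev) (n : ℕ) : ℝ[X] :=
  J.A3 (n - 1) + J.B3 (n - 1) * J.recFactor n

/-- The determinant `Δ_n`. -/
noncomputable def Delta (J : JacobiSobolev) (n : ℕ) : ℝ[X] :=
  J.A2 n * J.D2 n - J.C2 n * J.B2 n

/-- `δ_n`, the quotient of `Δ_n` by `ρ` (the division is exact: this is part of the theorem). -/
noncomputable def delta (J : JacobiSobolev) (n : ℕ) : ℝ[X] := J.Delta n /ₘ J.rho

/-- `q_{0,n}`. -/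
noncomputable def q0 (J : JacobiSobolev) (n : ℕ) : ℝ[X] := (1 - X ^ 2) * J.Delta n

/-- `q_{1,n}`. -/
noncomputable def q1 (J : JacobiSobolev) (n : ℕ) : ℝ[X] :=
  J.B3 n * J.A2 n - J.A3 n * J.B2 n

/-- `q_{2,n}`. -/
noncomputable def q2 (J : JacobiSobolev) (n : ℕ) : ℝ[X] :=
  (1 - X ^ 2) * derivative J.rho * J.delta n + J.B3 n * J.C2 n - J.A3 n * J.D2 n

/-- `q_{3,n}`. -/
noncomputable def q3 (J : JacobiSobolev) (n : ℕ) : ℝ[X] :=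
  (1 - X ^ 2) * derivative J.rho * J.delta n + J.C3 n * J.B2 n - J.D3 n * J.A2 n

/-- `q_{4,n}`. -/
noncomputable def q4 (J : JacobiSobolev) (n : ℕ) : ℝ[X] :=
  J.C3 n * J.D2 n - J.D3 n * J.C2 n

/-- A polynomial viewed as a rational function. -/
noncomputable abbrev toRat (p : ℝ[X]) : RatFunc ℝ := algebraMap ℝ[X] (RatFunc ℝ) p

/-- `A_{4,n} = q_{2,n} / q_{1,n}`. -/
noncomputable def A4 (J : JacobiSobolev) (n : ℕ) : RatFunc ℝ := toRat (J.q2 n) / toRat (J.q1 n)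

/-- `B_{4,n} = q_{0,n} / q_{1,n}`. -/
noncomputable def B4 (J : JacobiSobolev) (n : ℕ) : RatFunc ℝ := toRat (J.q0 n) / toRat (J.q1 n)

/-- `C_{4,n} = q_{3,n} / q_{4,n}`. -/
noncomputable def C4 (J : JacobiSobolev) (n : ℕ) : RatFunc ℝ := toRat (J.q3 n) / toRat (J.q4 n)

/-- `D_{4,n} = q_{0,n} / q_{4,n}`. -/
noncomputable def D4 (J : JacobiSobolev) (n : ℕ) : RatFunc ℝ := toRat (J.q0 n) / toRat (J.q4 n)

end JacobiSobolev

/-! All identities are computed among combinations of `P n` and `P (n-1)` with polynomial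
coefficients. Sobolev orthogonality gives `S n` as `P n` minus a combination of `y`-derivatives of
the Christoffel–Darboux kernel at the mass points (`S_expansion`). Multiplication by ρ clears the
denominators `(x - c_j)^(k+1)` and yields ρ S_n = A₂ P_n + B₂ P_{n-1} (`rho_mul_S`). The structure
relations (`jacobi_structure`, `jacobi_structure_pred`) keep such combinations stable under (1 - x²)
d/dx, so that (1 - x²)(ρ S_n)' = A₃ P_n + B₃ P_{n-1}. The three-term recurrence writes ρ S_{n-1} and
its derivative in the same two polynomials, with coefficients C_i and D_i.

Cramer's rule then expresses Δ P_n and Δ P_{n-1} as ρ times combinations of S_n and S_{n-1}.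
Consecutive P's are coprime, hence ρ divides Δ (`Delta_eq`). Inserting these expressions into the
two derivative formulas and cancelling ρ gives both ladder equations.

The exact degrees come from explicit top coefficients, in which `d` always cancels. They are nonzero
because the coefficient σ_n of x^(d-1) in B₂ is nonnegative (`sigma_nonneg`), so that κ = 1 + σ/γ₂ >
0.

The Jacobi weight enters only through positivity and the Pearson equation `jacobiL_pearson`; the
explicit γ₁, γ₂ and hatted coefficients follow from these by algebra. -/

/-! ### The Jacobi functional -/

/-- The functional `f ↦ ∫_{-1}^{1} f (1 - x)^α (1 + x)^β dx` on polynomials. -/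
noncomputable def jacobiL {α β : ℝ} (hα : -1 < α) (hβ : -1 < β) : ℝ[X] →ₗ[ℝ] ℝ where
  toFun f := jacobiInner α β 1 f
  map_add' f g := jacobiInner_add_right hα hβ 1 f g
  map_smul' a f := by simp [smul_eq_C_mul, jacobiInner_smul_right]

theorem jacobiL_apply {α β : ℝ} (hα : -1 < α) (hβ : -1 < β) (f : ℝ[X]) :
    jacobiL hα hβ f = ∫ x in (-1 : ℝ)..1, f.eval x * ((1 - x) ^ α * (1 + x) ^ β) := by
  simp [jacobiL, jacobiInner]

theorem jacobiInner_eq_jacobiL {α β : ℝ} (hα : -1 < α) (hβ : -1 < β) (f g : ℝ[X]) :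
    jacobiInner α β f g = jacobiL hα hβ (f * g) := by
  simp [jacobiL_apply, jacobiInner]

theorem jacobiL_mul_self_pos {α β : ℝ} (hα : -1 < α) (hβ : -1 < β) {f : ℝ[X]} (hf : f ≠ 0) :
    0 < jacobiL hα hβ (f * f) := by
  rw [jacobiL_apply]
  have hint := intervalIntegrable_jacobi hα hβ (f * f)
  have hle : (-1 : ℝ) ≤ 1 := by norm_num
  have hnn : ∀ x ∈ Set.Ioc (-1 : ℝ) 1,
      0 ≤ (f * f).eval x * ((1 - x) ^ α * (1 + x) ^ β) := by
    intro x hx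
    rw [eval_mul]
    exact mul_nonneg (mul_self_nonneg _)
      (mul_nonneg (Real.rpow_nonneg (by linarith [hx.2]) _)
        (Real.rpow_nonneg (by linarith [hx.1]) _))
  rw [intervalIntegral.integral_of_le hle,
    MeasureTheory.setIntegral_pos_iff_support_of_nonneg_ae
      ((MeasureTheory.ae_restrict_iff' measurableSet_Ioc).2 (Filter.Eventually.of_forall hnn))
      ((intervalIntegrable_iff_integrableOn_Ioc_of_le hle).1 hint)]
  -- The endpoints are left out because there the weight involves a power of zero, which Lean
  -- evaluates by convention; the finitely many roots of `f` are null.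
  have hsub : Set.Ioo (-1 : ℝ) 1 \ (f.roots.toFinset : Set ℝ) ⊆
      (Function.support fun x => (f * f).eval x * ((1 - x) ^ α * (1 + x) ^ β)) ∩
        Set.Ioc (-1 : ℝ) 1 := by
    rintro x ⟨hx, hroot⟩
    refine ⟨?_, hx.1, hx.2.le⟩
    have h0 : f.eval x ≠ 0 := fun h => hroot (by simp [hf, h])
    rw [Function.mem_support, eval_mul]
    exact mul_ne_zero (mul_ne_zero h0 h0)
      (mul_ne_zero (Real.rpow_pos_of_pos (by linarith [hx.2]) _).ne'
        (Real.rpow_pos_of_pos (by linarith [hx.1]) _).ne')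
  refine lt_of_lt_of_le ?_ (MeasureTheory.measure_mono hsub)
  rw [MeasureTheory.measure_sdiff_null ((Finset.finite_toSet _).measure_zero _), Real.volume_Ioo]
  norm_num

/-- The integrand is the derivative of f (1-x)^(α+1) (1+x)^(β+1), which vanishes at both endpoints
since α, β > -1. -/
theorem jacobiL_pearson {α β : ℝ} (hα : -1 < α) (hβ : -1 < β) (f : ℝ[X]) :
    jacobiL hα hβ ((1 - X ^ 2) * derivative f + (C (β - α) - C (α + β + 2) * X) * f) = 0 := by
  rw [jacobiL_apply]
  have hle : (-1 : ℝ) ≤ 1 := by norm_num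
  rw [intervalIntegral.integral_eq_sub_of_hasDerivAt_of_le
    (f := fun x => f.eval x * ((1 - x) ^ (α + 1) * (1 + x) ^ (β + 1))) hle ?_ ?_
    (intervalIntegrable_jacobi hα hβ _)]
  · have h1 : α + 1 ≠ 0 := by linarith
    have h2 : β + 1 ≠ 0 := by linarith
    simp [Real.zero_rpow h1, Real.zero_rpow h2]
  · apply ContinuousOn.mul f.continuous.continuousOn
    apply Continuous.continuousOn
    apply Continuous.mul
    · exact Continuous.rpow_const (by fun_prop) fun x => Or.inr (by linarith)
    · exact Continuous.rpow_const (by fun_prop) fun x => Or.inr (by linarith)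
  · intro x hx
    have hx1 : 0 < 1 - x := by linarith [hx.2]
    have hx2 : 0 < 1 + x := by linarith [hx.1]
    have d1 : HasDerivAt (fun x : ℝ => (1 - x) ^ (α + 1)) ((-1) * (α + 1) * (1 - x) ^ (α + 1 - 1)) x :=
      ((hasDerivAt_id x).const_sub 1).rpow_const (Or.inl hx1.ne')
    have d2 : HasDerivAt (fun x : ℝ => (1 + x) ^ (β + 1)) (1 * (β + 1) * (1 + x) ^ (β + 1 - 1)) x :=
      ((hasDerivAt_id x).const_add 1).rpow_const (Or.inl hx2.ne')
    refine ((f.hasDerivAt x).mul (d1.mul d2)).congr_deriv ?_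
    simp only [Pi.mul_apply, eval_add, eval_mul, eval_sub, eval_one, eval_pow, eval_X, eval_C,
      add_sub_cancel_right, Real.rpow_add_one hx1.ne', Real.rpow_add_one hx2.ne']
    ring

/-! ### Orthogonal polynomials of a positive functional -/

/-- `P` is the sequence of monic orthogonal polynomials of the positive functional `L`. -/
structure IsMonicOrthSeq (L : ℝ[X] →ₗ[ℝ] ℝ) (P : ℕ → ℝ[X]) : Prop where
  pos : ∀ f ≠ 0, 0 < L (f * f)
  monic : ∀ n, (P n).Monic
  natDegree : ∀ n, (P n).natDegree = n
  orth : ∀ n, ∀ k < n, L (X ^ k * P n) = 0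

theorem natDegree_eq_of_isLowestMonicOrth {B : ℝ[X] → ℝ[X] → ℝ}
    (hadd : ∀ f g h, B f (g + h) = B f g + B f h)
    (hsmul : ∀ (a : ℝ) (f g : ℝ[X]), B f (C a * g) = a * B f g)
    (hsymm : ∀ f g, B f g = B g f) (hpos : ∀ f ≠ 0, 0 < B f f) {n : ℕ} {p : ℝ[X]}
    (hp : IsLowestMonicOrth B n p) : p.natDegree = n := by
  let φ (f : ℝ[X]) : ℝ[X] →ₗ[ℝ] ℝ :=
    { toFun := B f
      map_add' := hadd f
      map_smul' := fun a g => by simp [smul_eq_C_mul, hsmul] }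
  apply le_antisymm
  -- There are `n` linear conditions on `n + 1` coefficients, so some nonzero polynomial of degree
  -- at most `n` satisfies them; minimality of `p` does the rest.
  · let ψ : (Fin (n + 1) → ℝ) →ₗ[ℝ] (Fin n → ℝ) :=
      (LinearMap.pi fun k : Fin n => φ (X ^ (k : ℕ))) ∘ₗ
        (degreeLT ℝ (n + 1)).subtype ∘ₗ (degreeLTEquiv ℝ (n + 1)).symm.toLinearMap
    have hker : LinearMap.ker ψ ≠ ⊥ := LinearMap.ker_ne_bot_of_finrank_lt (by simp)
    obtain ⟨v, hv, hv0⟩ := (Submodule.ne_bot_iff _).1 hker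
    set q := (degreeLTEquiv ℝ (n + 1)).symm v with hq
    have hq0 : (q : ℝ[X]) ≠ 0 := by simpa [hq] using hv0
    have hqd : (q : ℝ[X]).natDegree ≤ n := by
      have := mem_degreeLT.1 q.2
      exact Nat.lt_succ_iff.1 ((natDegree_lt_iff_degree_lt hq0).2 this)
    have hmon : IsMonicOrth B n (C (q : ℝ[X]).leadingCoeff⁻¹ * q) := by
      refine ⟨by rw [mul_comm]; exact monic_mul_leadingCoeff_inv hq0, fun k hk => ?_⟩
      have h := congrFun (LinearMap.mem_ker.1 hv) ⟨k, hk⟩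
      have h' : B (X ^ k) q = 0 := by simpa [ψ, φ, hq] using h
      rw [hsmul, h', mul_zero]
    exact (hp.2 _ hmon).trans ((natDegree_C_mul_le _ _).trans hqd)
  -- A solution of degree below `n` would be orthogonal to each of its own monomials, hence to
  -- itself.
  · by_contra! hlt
    have h0 : B p p = 0 := by
      change φ p p = 0
      conv_lhs => arg 2; rw [p.as_sum_range_C_mul_X_pow]
      rw [map_sum]
      refine Finset.sum_eq_zero fun i hi => ?_
      rw [← smul_eq_C_mul, map_smul]
      have : φ p (X ^ i) = 0 := by
        change B p (X ^ i) = 0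
        rw [hsymm]
        exact hp.1.2 i (by have := Finset.mem_range.1 hi; omega)
      rw [this, smul_zero]
    exact (hpos p hp.1.1.ne_zero).ne' h0

namespace IsMonicOrthSeq

variable {L : ℝ[X] →ₗ[ℝ] ℝ} {P : ℕ → ℝ[X]}

theorem L_C_mul (L : ℝ[X] →ₗ[ℝ] ℝ) (a : ℝ) (f : ℝ[X]) : L (C a * f) = a * L f := by
  rw [← smul_eq_C_mul, map_smul, smul_eq_mul]

theorem norm_pos (hP : IsMonicOrthSeq L P) (n : ℕ) : 0 < L (P n * P n) :=
  hP.pos _ (hP.monic n).ne_zero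

theorem degree (hP : IsMonicOrthSeq L P) (n : ℕ) : (P n).degree = n := by
  rw [degree_eq_natDegree (hP.monic n).ne_zero, hP.natDegree]

theorem coeff_self (hP : IsMonicOrthSeq L P) (n : ℕ) : (P n).coeff n = 1 := by
  have := hP.monic n
  rwa [Monic, leadingCoeff, hP.natDegree] at this

theorem zero_eq_one (hP : IsMonicOrthSeq L P) : P 0 = 1 :=
  (hP.monic 0).natDegree_eq_zero.1 (hP.natDegree 0)

theorem orth_of_degree_lt (hP : IsMonicOrthSeq L P) {n : ℕ} {f : ℝ[X]} (hf : f.degree < n) :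
    L (f * P n) = 0 := by
  rw [f.as_sum_range_C_mul_X_pow, Finset.sum_mul, map_sum]
  refine Finset.sum_eq_zero fun i _ => ?_
  rw [mul_assoc, L_C_mul]
  rcases lt_or_ge i n with hi | hi
  · rw [hP.orth n i hi, mul_zero]
  · rw [coeff_eq_zero_of_degree_lt (hf.trans_le (by exact_mod_cast hi)), zero_mul]

theorem orth_of_lt (hP : IsMonicOrthSeq L P) {i n : ℕ} (h : i < n) : L (P i * P n) = 0 :=
  hP.orth_of_degree_lt (by rw [hP.degree]; exact_mod_cast h)

theorem orth_of_ne (hP : IsMonicOrthSeq L P) {i n : ℕ} (h : i ≠ n) : L (P i * P n) = 0 := by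
  rcases lt_or_gt_of_ne h with h | h
  · exact hP.orth_of_lt h
  · rw [mul_comm]
    exact hP.orth_of_lt h

theorem degree_sub_lt (hP : IsMonicOrthSeq L P) {n : ℕ} {f : ℝ[X]} (hf : f.degree < ((n + 1 : ℕ) : WithBot ℕ)) :
    (f - C (f.coeff n) * P n).degree < n := by
  rw [degree_lt_iff_coeff_zero]
  intro m hm
  rcases hm.eq_or_lt with rfl | hm
  · simp [hP.coeff_self]
  · rw [coeff_sub, coeff_C_mul, coeff_eq_zero_of_degree_lt (hf.trans_le (by exact_mod_cast hm)),
      coeff_eq_zero_of_natDegree_lt (p := P n) (by rw [hP.natDegree]; exact hm)]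
    simp

theorem exists_expansion (hP : IsMonicOrthSeq L P) (n : ℕ) :
    ∀ f : ℝ[X], f.degree < n → ∃ a : ℕ → ℝ, f = ∑ i ∈ Finset.range n, C (a i) * P i := by
  induction n with
  | zero =>
    intro f hf
    exact ⟨0, by simpa using hf⟩
  | succ n ih =>
    intro f hf
    obtain ⟨a, ha⟩ := ih _ (hP.degree_sub_lt hf)
    refine ⟨fun i => if i = n then f.coeff n else a i, ?_⟩
    rw [Finset.sum_range_succ]
    simp only [if_true]
    rw [← sub_eq_iff_eq_add, ha]
    refine Finset.sum_congr rfl fun i hi => ?_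
    rw [if_neg (Finset.mem_range.1 hi).ne]

theorem expansion (hP : IsMonicOrthSeq L P) {n : ℕ} {f : ℝ[X]} (hf : f.degree < n) :
    f = ∑ i ∈ Finset.range n, C (L (f * P i) / L (P i * P i)) * P i := by
  obtain ⟨a, ha⟩ := hP.exists_expansion n f hf
  conv_lhs => rw [ha]
  refine Finset.sum_congr rfl fun j hj => ?_
  congr 2
  rw [eq_div_iff (hP.norm_pos j).ne', ha, Finset.sum_mul, map_sum, Finset.sum_eq_single_of_mem j hj]
  · rw [mul_assoc, L_C_mul]
  · intro i _ hij
    rw [mul_assoc, L_C_mul, hP.orth_of_ne hij, mul_zero]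

theorem eq_zero_of_orth (hP : IsMonicOrthSeq L P) {n : ℕ} {f : ℝ[X]} (hf : f.degree < n)
    (h : ∀ i < n, L (f * P i) = 0) : f = 0 := by
  rw [hP.expansion hf]
  exact Finset.sum_eq_zero fun i hi => by simp [h i (Finset.mem_range.1 hi)]

/-- A polynomial `f` of degree at most `n` has `L (f P_n) = f_n L (P_n ^ 2)`. -/
theorem L_mul_of_degree_lt_succ (hP : IsMonicOrthSeq L P) {n : ℕ} {f : ℝ[X]}
    (hf : f.degree < ((n + 1 : ℕ) : WithBot ℕ)) : L (f * P n) = f.coeff n * L (P n * P n) := by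
  have h := hP.orth_of_degree_lt (hP.degree_sub_lt hf)
  rw [sub_mul, map_sub, mul_assoc, L_C_mul] at h
  linarith

theorem degree_X_mul_sub (hP : IsMonicOrthSeq L P) (n : ℕ) :
    (X * P n - P (n + 1)).degree < ((n + 1 : ℕ) : WithBot ℕ) := by
  have h : (X * P n).degree < ((n + 1 + 1 : ℕ) : WithBot ℕ) := by
    rw [degree_mul, degree_X, hP.degree]
    norm_cast
    omega
  simpa [hP.coeff_self] using hP.degree_sub_lt h

theorem exists_recurrence_zero (hP : IsMonicOrthSeq L P) :
    ∃ b : ℝ, X * P 0 = P 1 + C b * P 0 := by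
  have h := hP.expansion (hP.degree_X_mul_sub 0)
  rw [Finset.sum_range_one] at h
  exact ⟨_, by rw [← h]; ring⟩

/-- If `f` of degree at most `n + 2` is orthogonal to `P_i` for `i < n`, then `f` is a
combination of `P_{n+2}`, `P_{n+1}` and `P_n`. -/
theorem exists_three_terms (hP : IsMonicOrthSeq L P) {n : ℕ} {f : ℝ[X]}
    (hf : f.degree < ((n + 3 : ℕ) : WithBot ℕ)) (ho : ∀ i < n, L (f * P i) = 0) :
    ∃ b : ℝ, f = C (f.coeff (n + 2)) * P (n + 2) + C b * P (n + 1) +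
      C (L (f * P n) / L (P n * P n)) * P n := by
  have h := hP.expansion (hP.degree_sub_lt (n := n + 2) hf)
  rw [Finset.sum_range_succ, Finset.sum_range_succ, Finset.sum_eq_zero, zero_add] at h
  · rw [sub_eq_iff_eq_add] at h
    refine ⟨L ((f - C (f.coeff (n + 2)) * P (n + 2)) * P (n + 1)) / L (P (n + 1) * P (n + 1)),
      h.trans ?_⟩
    have : L ((f - C (f.coeff (n + 2)) * P (n + 2)) * P n) = L (f * P n) := by
      rw [sub_mul, map_sub, mul_assoc, L_C_mul, hP.orth_of_ne (by omega)]
      simp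
    rw [this]
    ring
  · intro i hi
    have hi := Finset.mem_range.1 hi
    rw [sub_mul, map_sub, ho i hi, mul_assoc, L_C_mul, hP.orth_of_ne (by omega)]
    simp

theorem exists_recurrence (hP : IsMonicOrthSeq L P) (n : ℕ) :
    ∃ b : ℝ, X * P (n + 1) = P (n + 2) + C b * P (n + 1) +
      C (L (P (n + 1) * P (n + 1)) / L (P n * P n)) * P n := by
  have hd (i : ℕ) : (X * P i).degree = ((i + 1 : ℕ) : WithBot ℕ) := by
    rw [degree_mul, degree_X, hP.degree]
    norm_cast
    omega
  have hc (f : ℝ[X]) : X * P (n + 1) * f = X * f * P (n + 1) := by ring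
  obtain ⟨b, hb⟩ := hP.exists_three_terms (n := n) (f := X * P (n + 1))
    (by rw [hd]; norm_cast; omega) (fun i hi => by
      rw [hc]
      exact hP.orth_of_degree_lt (by rw [hd]; norm_cast; omega))
  refine ⟨b, ?_⟩
  rw [hc, hP.L_mul_of_degree_lt_succ (f := X * P n) (by rw [hd]; norm_cast; omega)] at hb
  simpa [hP.coeff_self] using hb

/-- The Christoffel–Darboux formula with a linear functional `t` in place of evaluation. -/
theorem christoffel_darboux (hP : IsMonicOrthSeq L P) (t : ℝ[X] →ₗ[ℝ] ℝ) (n : ℕ) :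
    ∑ i ∈ Finset.range (n + 1), C (L (P i * P i))⁻¹ * (C (t (P i)) * X - C (t (X * P i))) * P i =
      C (L (P n * P n))⁻¹ * (C (t (P n)) * P (n + 1) - C (t (P (n + 1))) * P n) := by
  induction n with
  | zero =>
    obtain ⟨b, hb⟩ := hP.exists_recurrence_zero
    have ht : t (X * P 0) = t (P 1) + b * t (P 0) := by rw [hb, map_add, L_C_mul]
    rw [Finset.sum_range_one, ht, zero_add]
    simp only [C_add, C_mul]
    linear_combination C (L (P 0 * P 0))⁻¹ * C (t (P 0)) * hb
  | succ n ih =>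
    obtain ⟨b, hb⟩ := hP.exists_recurrence n
    have ht : t (X * P (n + 1)) = t (P (n + 2)) + b * t (P (n + 1)) +
        L (P (n + 1) * P (n + 1)) / L (P n * P n) * t (P n) := by
      rw [hb, map_add, map_add, L_C_mul, L_C_mul]
    have h1 : C (L (P (n + 1) * P (n + 1)))⁻¹ * C (L (P (n + 1) * P (n + 1))) = (1 : ℝ[X]) := by
      rw [← C_mul, inv_mul_cancel₀ (hP.norm_pos _).ne', C_1]
    rw [Finset.sum_range_succ, ih, ht]
    simp only [C_add, C_mul, div_eq_mul_inv] at hb ⊢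
    linear_combination C (L (P (n + 1) * P (n + 1)))⁻¹ * C (t (P (n + 1))) * hb +
      C (L (P n * P n))⁻¹ * (P n * C (t (P (n + 1))) - C (t (P n)) * P (n + 1)) * h1

/-- A Bézout identity passes up the recurrence, whose last coefficient is a ratio of positive norms
and so can be inverted. -/
theorem isCoprime_succ (hP : IsMonicOrthSeq L P) (n : ℕ) : IsCoprime (P (n + 1)) (P n) := by
  induction n with
  | zero => rw [hP.zero_eq_one]; exact isCoprime_one_right
  | succ n ih =>
    obtain ⟨b, hb⟩ := hP.exists_recurrence n
    obtain ⟨u, v, huv⟩ := ih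
    set g := L (P (n + 1) * P (n + 1)) / L (P n * P n)
    have hg : C g⁻¹ * C g = (1 : ℝ[X]) := by
      rw [← C_mul, inv_mul_cancel₀ (div_pos (hP.norm_pos _) (hP.norm_pos _)).ne', C_1]
    refine ⟨-(v * C g⁻¹), u + v * C g⁻¹ * (X - C b), ?_⟩
    linear_combination huv + v * C g⁻¹ * hb + v * P n * hg

/-! ### Functionals with a Jacobi Pearson equation -/

section Pearson

variable {α β : ℝ}

/-- Integration by parts: the Pearson equation applied to the product `f * g`. -/
theorem L_derivative_mul (hL : ∀ f, L ((1 - X ^ 2) * derivative f +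
      (C (β - α) - C (α + β + 2) * X) * f) = 0) (f g : ℝ[X]) :
    L ((1 - X ^ 2) * derivative f * g) =
      -L (((1 - X ^ 2) * derivative g + (C (β - α) - C (α + β + 2) * X) * g) * f) := by
  rw [eq_neg_iff_add_eq_zero, ← map_add, ← hL (f * g), derivative_mul]
  congr 1
  ring

theorem coeff_one_sub_X_sq_mul_derivative (f : ℝ[X]) (k : ℕ) :
    ((1 - X ^ 2) * derivative f).coeff (k + 1) = (k + 2) * f.coeff (k + 2) - k * f.coeff k := by
  have : (1 - X ^ 2) * derivative f = derivative f - X * (X * derivative f) := by ring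
  rw [this, coeff_sub, coeff_X_mul, coeff_derivative]
  cases k with
  | zero => simp; ring
  | succ k => rw [coeff_X_mul, coeff_derivative]; push_cast; ring

theorem degree_pearson_lt {n : ℕ} {f : ℝ[X]} (hf : f.degree < n) :
    ((1 - X ^ 2) * derivative f + (C (β - α) - C (α + β + 2) * X) * f).degree < ((n + 1 : ℕ) : WithBot ℕ) := by
  rw [degree_lt_iff_coeff_zero] at hf ⊢
  intro m hm
  obtain ⟨k, rfl⟩ : ∃ k, m = k + 1 := ⟨m - 1, by omega⟩
  rw [coeff_add, coeff_one_sub_X_sq_mul_derivative, sub_mul, coeff_sub, coeff_C_mul, mul_assoc,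
    coeff_C_mul, coeff_X_mul, hf k (by omega), hf (k + 1) (by omega), hf (k + 2) (by omega)]
  simp

theorem coeff_jacobi_operator (f : ℝ[X]) (k : ℕ) :
    ((1 - X ^ 2) * derivative (derivative f) +
        (C (β - α) - C (α + β + 2) * X) * derivative f).coeff k =
      (k + 1) * (k + 2) * f.coeff (k + 2) + (β - α) * (k + 1) * f.coeff (k + 1)
        - k * (k + α + β + 1) * f.coeff k := by
  have : (1 - X ^ 2) * derivative (derivative f) +
        (C (β - α) - C (α + β + 2) * X) * derivative f =
      derivative (derivative f) - X * (X * derivative (derivative f)) + C (β - α) * derivative f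
        - C (α + β + 2) * (X * derivative f) := by ring
  rw [this]
  rcases k with _ | _ | k
  · simp only [coeff_sub, coeff_add, coeff_X_mul_zero, coeff_C_mul, coeff_derivative]
    push_cast
    ring
  · simp only [coeff_sub, coeff_add, coeff_X_mul, coeff_X_mul_zero, coeff_C_mul, coeff_derivative,
      zero_add]
    push_cast
    ring
  · simp only [coeff_sub, coeff_add, coeff_X_mul, coeff_C_mul, coeff_derivative]
    push_cast
    ring

/-- The second-order operator is symmetric for `L` and does not raise degrees. The left side
therefore has degree below `n`, its top coefficient cancelling by the choice of eigenvalue, and it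
is orthogonal to every `P i` with `i < n`. -/
theorem jacobi_ode (hP : IsMonicOrthSeq L P) (hL : ∀ f, L ((1 - X ^ 2) * derivative f +
      (C (β - α) - C (α + β + 2) * X) * f) = 0) (n : ℕ) :
    (1 - X ^ 2) * derivative (derivative (P n)) +
      (C (β - α) - C (α + β + 2) * X) * derivative (P n) + C (n * (n + α + β + 1)) * P n = 0 := by
  have hz {k : ℕ} (hk : n < k) : (P n).coeff k = 0 :=
    coeff_eq_zero_of_natDegree_lt (by rw [hP.natDegree]; exact hk)
  have hself (f g : ℝ[X]) : L (((1 - X ^ 2) * derivative (derivative f) +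
        (C (β - α) - C (α + β + 2) * X) * derivative f) * g) =
      -L ((1 - X ^ 2) * derivative f * derivative g) := by
    have := hL (derivative f * g)
    rw [eq_neg_iff_add_eq_zero, ← map_add, ← this, derivative_mul]
    congr 1
    ring
  refine hP.eq_zero_of_orth (n := n) ?_ fun i hi => ?_
  · rw [degree_lt_iff_coeff_zero]
    intro k hk
    rw [coeff_add, coeff_jacobi_operator, coeff_C_mul, hz (show n < k + 2 by omega),
      hz (show n < k + 1 by omega)]
    rcases hk.eq_or_lt with rfl | hk
    · ring
    · rw [hz hk]
      ring
  -- Using `hself` in both directions moves the operator from `P n` onto `P i`, where its image has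
  -- degree at most `i < n`.
  · rw [add_mul, map_add, hself, mul_assoc (C _), L_C_mul, hP.orth_of_ne hi.ne',
      mul_right_comm, ← hself, hP.orth_of_degree_lt]
    · simp
    · rw [degree_lt_iff_coeff_zero]
      intro k hk
      have hz' {k : ℕ} (hk : i < k) : (P i).coeff k = 0 :=
        coeff_eq_zero_of_natDegree_lt (by rw [hP.natDegree]; exact hk)
      rw [coeff_jacobi_operator, hz' (show i < k + 2 by omega),
        hz' (show i < k + 1 by omega), hz' (show i < k by omega)]
      ring

theorem jacobi_coeff (hP : IsMonicOrthSeq L P) (hL : ∀ f, L ((1 - X ^ 2) * derivative f +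
      (C (β - α) - C (α + β + 2) * X) * f) = 0) (n k : ℕ) :
    (k + 1) * (k + 2) * (P n).coeff (k + 2) + (β - α) * (k + 1) * (P n).coeff (k + 1)
        - k * (k + α + β + 1) * (P n).coeff k + n * (n + α + β + 1) * (P n).coeff k = 0 := by
  rw [← coeff_jacobi_operator, ← coeff_C_mul, ← coeff_add, hP.jacobi_ode hL, coeff_zero]

end Pearson

end IsMonicOrthSeq

/-! ### Explicit recurrence and structure relations for Jacobi polynomials. -/

namespace IsMonicOrthSeq

variable {L : ℝ[X] →ₗ[ℝ] ℝ} {P : ℕ → ℝ[X]} {α β : ℝ}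

theorem coeff_of_lt (hP : IsMonicOrthSeq L P) {n k : ℕ} (hk : n < k) : (P n).coeff k = 0 :=
  coeff_eq_zero_of_natDegree_lt (by rw [hP.natDegree]; exact hk)

theorem coeff_pred (hP : IsMonicOrthSeq L P) (hα : -1 < α) (hβ : -1 < β)
    (hL : ∀ f, L ((1 - X ^ 2) * derivative f + (C (β - α) - C (α + β + 2) * X) * f) = 0) (n : ℕ) :
    (P (n + 1)).coeff n = (n + 1) * (α - β) / (2 * n + 2 + α + β) := by
  have h := hP.jacobi_coeff hL (n + 1) n
  rw [hP.coeff_of_lt (show n + 1 < n + 2 by omega), hP.coeff_self] at h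
  have hn : (0 : ℝ) ≤ n := n.cast_nonneg
  rw [eq_div_iff (by linarith)]
  push_cast at h
  linear_combination h

theorem coeff_pred_pred (hP : IsMonicOrthSeq L P) (hα : -1 < α) (hβ : -1 < β)
    (hL : ∀ f, L ((1 - X ^ 2) * derivative f + (C (β - α) - C (α + β + 2) * X) * f) = 0) (n : ℕ) :
    (P (n + 2)).coeff n = ((β - α) ^ 2 * (n + 1) * (n + 2) / (2 * n + 4 + α + β)
      - (n + 1) * (n + 2)) / (2 * (2 * n + 3 + α + β)) := by
  have h := hP.jacobi_coeff hL (n + 2) n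
  have h1 := hP.coeff_pred hα hβ hL (n + 1)
  rw [hP.coeff_self, h1] at h
  have hn : (0 : ℝ) ≤ n := n.cast_nonneg
  have h4 : 2 * (n : ℝ) + 4 + α + β ≠ 0 := by linarith
  rw [eq_div_iff (by linarith)]
  push_cast at h
  rw [show 2 * ((n : ℝ) + 1) + 2 + α + β = 2 * n + 4 + α + β by ring] at h
  rw [← sub_eq_zero, ← h]
  field_simp
  ring

theorem gamma2_pos (hα : -1 < α) (hβ : -1 < β) (n : ℕ) : 0 < gamma2 α β (n + 1) := by
  unfold gamma2
  rcases n with _ | n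
  · have : 0 < 1 + α := by linarith
    have : 0 < 1 + β := by linarith
    have : 0 < 2 + α + β := by linarith
    have : 0 < 3 + α + β := by linarith
    simp only [zero_add, if_true]
    positivity
  · rw [if_neg (by omega)]
    have hn : (0 : ℝ) ≤ n := n.cast_nonneg
    push_cast
    have h1 : 0 < (n : ℝ) + 1 + 1 + α := by linarith
    have h2 : 0 < (n : ℝ) + 1 + 1 + β := by linarith
    have h3 : 0 < (n : ℝ) + 1 + 1 + α + β := by linarith
    have h4 : 0 < 2 * ((n : ℝ) + 1 + 1) + α + β := by linarith
    have h5 : 0 < (2 * ((n : ℝ) + 1 + 1) + α + β) ^ 2 - 1 := by nlinarith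
    positivity

/-- This factored form is the one that arises in the structure relation, and it is what makes the
top coefficients of `D3`, `q1` and `q4` collapse. -/
theorem bHat_eq (hα : -1 < α) (hβ : -1 < β) (n : ℕ) :
    bHat α β (n + 1) = (2 * n + 3 + α + β) * gamma2 α β (n + 1) := by
  unfold bHat gamma2
  rcases n with _ | n
  · have : 2 + α + β ≠ 0 := by linarith
    have : 3 + α + β ≠ 0 := by linarith
    simp only [zero_add, if_true, Nat.cast_zero, mul_zero]
    field_simp
  · rw [if_neg (by omega), if_neg (by omega)]
    have hn : (0 : ℝ) ≤ n := n.cast_nonneg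
    push_cast
    have h4 : 2 * ((n : ℝ) + 1 + 1) + α + β ≠ 0 := by linarith
    have h5 : 2 * ((n : ℝ) + 1 + 1) + α + β - 1 ≠ 0 := by linarith
    have h6 : 2 * ((n : ℝ) + 1) + 3 + α + β ≠ 0 := by linarith
    rw [show (2 * ((n : ℝ) + 1 + 1) + α + β) ^ 2 - 1 =
      (2 * ((n : ℝ) + 1 + 1) + α + β - 1) * (2 * ((n : ℝ) + 1) + 3 + α + β) by ring]
    generalize 2 * ((n : ℝ) + 1 + 1) + α + β - 1 = D at *
    generalize 2 * ((n : ℝ) + 1 + 1) + α + β = E at *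
    generalize 2 * ((n : ℝ) + 1) + 3 + α + β = F at *
    field_simp

theorem jacobi_recurrence_aux (hP : IsMonicOrthSeq L P) (hα : -1 < α) (hβ : -1 < β)
    (hL : ∀ f, L ((1 - X ^ 2) * derivative f + (C (β - α) - C (α + β + 2) * X) * f) = 0) (n : ℕ) :
    L (P (n + 1) * P (n + 1)) / L (P n * P n) = gamma2 α β (n + 1) ∧
    X * P (n + 1) = P (n + 2) + C (gamma1 α β (n + 1)) * P (n + 1) +
      C (gamma2 α β (n + 1)) * P n := by
  obtain ⟨b, hb⟩ := hP.exists_recurrence n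
  set g := L (P (n + 1) * P (n + 1)) / L (P n * P n)
  have hn : (0 : ℝ) ≤ n := n.cast_nonneg
  have h2 : 2 * (n : ℝ) + 2 + α + β ≠ 0 := by linarith
  have h3 : 2 * (n : ℝ) + 3 + α + β ≠ 0 := by linarith
  have h4 : 2 * (n : ℝ) + 4 + α + β ≠ 0 := by linarith
  have hp1 := hP.coeff_pred hα hβ hL n
  have hp2 := hP.coeff_pred hα hβ hL (n + 1)
  have hr2 := hP.coeff_pred_pred hα hβ hL n
  -- The coefficients of `x^(n+1)` and `x^n` in the recurrence determine `b` and then `g`, since the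
  -- ODE has already fixed the two subleading coefficients of each `P`.
  have e1 := congrArg (fun f => f.coeff (n + 1)) hb
  have e0 := congrArg (fun f => f.coeff n) hb
  simp only [coeff_add, coeff_C_mul, coeff_X_mul, hP.coeff_self, hp1, hp2, hr2,
    hP.coeff_of_lt (Nat.lt_succ_self n)] at e1 e0
  push_cast at e1
  rw [show 2 * ((n : ℝ) + 1) + 2 + α + β = 2 * n + 4 + α + β by ring] at e1
  have hb1 : b = gamma1 α β (n + 1) := by
    have : b = (n + 1) * (α - β) / (2 * n + 2 + α + β) -
      (n + 1 + 1) * (α - β) / (2 * n + 4 + α + β) := by linarith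
    rw [this, gamma1]
    push_cast
    rw [show 2 * ((n : ℝ) + 1) + α + β = 2 * n + 2 + α + β by ring,
      show 2 * (n : ℝ) + 2 + α + β + 2 = 2 * n + 4 + α + β by ring]
    clear hp1 hp2 hr2 e0 e1 this
    -- The denominators become atoms while fractions are cleared and are expanded only for the final
    -- `ring`.
    generalize h2' : 2 * (n : ℝ) + 2 + α + β = D2 at *
    generalize h4' : 2 * (n : ℝ) + 4 + α + β = D4 at *
    field_simp
    subst h2' h4'
    ring
  have hg : g = gamma2 α β (n + 1) := by
    rw [hb1, gamma1] at e0
    unfold gamma2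
    -- At index 1 there is no coefficient two below the top, and `gamma2` has its cancelled form.
    rcases n with _ | n
    · simp only [zero_add, if_true, coeff_X_mul_zero, Nat.cast_zero, Nat.cast_one, mul_zero,
        mul_one] at e0 ⊢
      have h2 : 2 + α + β ≠ 0 := by linarith
      have h3 : 3 + α + β ≠ 0 := by linarith
      have h4 : 4 + α + β ≠ 0 := by linarith
      rw [show 2 + α + β + 2 = 4 + α + β by ring] at e0
      rw [← sub_eq_zero, ← neg_eq_zero]
      rw [← sub_eq_zero] at e0
      rw [← e0]
      field_simp
      ring
    · rw [coeff_X_mul, hP.coeff_pred_pred hα hβ hL n] at e0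
      rw [if_neg (by omega)]
      push_cast at e0 ⊢
      have h1 : 2 * (n : ℝ) + 3 + α + β ≠ 0 := by linarith
      have h2 : 2 * (n : ℝ) + 4 + α + β ≠ 0 := by linarith
      have h3 : 2 * (n : ℝ) + 5 + α + β ≠ 0 := by linarith
      have h4 : 2 * (n : ℝ) + 6 + α + β ≠ 0 := by linarith
      rw [show 2 * ((n : ℝ) + 1 + 1) + α + β = 2 * n + 4 + α + β by ring,
        show 2 * (n : ℝ) + 4 + α + β + 2 = 2 * n + 6 + α + β by ring,
        show 2 * ((n : ℝ) + 1) + 4 + α + β = 2 * n + 6 + α + β by ring,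
        show 2 * ((n : ℝ) + 1) + 2 + α + β = 2 * n + 4 + α + β by ring,
        show 2 * ((n : ℝ) + 1) + 3 + α + β = 2 * n + 5 + α + β by ring] at e0
      rw [show 2 * ((n : ℝ) + 1 + 1) + α + β = 2 * n + 4 + α + β by ring,
        show (2 * (n : ℝ) + 4 + α + β) ^ 2 - 1 =
          (2 * (n : ℝ) + 3 + α + β) * (2 * n + 5 + α + β) by ring]
      clear hb1 e1 hr2 hp1 hp2 hb
      rw [← sub_eq_zero, ← neg_eq_zero]
      rw [← sub_eq_zero] at e0
      rw [← e0]
      clear e0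
      generalize h3' : 2 * (n : ℝ) + 3 + α + β = D3 at *
      generalize h4' : 2 * (n : ℝ) + 4 + α + β = D4 at *
      generalize h5' : 2 * (n : ℝ) + 5 + α + β = D5 at *
      generalize h6' : 2 * (n : ℝ) + 6 + α + β = D6 at *
      field_simp
      subst h3' h4' h5' h6'
      ring
  exact ⟨hg, by rw [hb, hb1, hg]⟩

theorem norm_div_norm (hP : IsMonicOrthSeq L P) (hα : -1 < α) (hβ : -1 < β)
    (hL : ∀ f, L ((1 - X ^ 2) * derivative f + (C (β - α) - C (α + β + 2) * X) * f) = 0) (n : ℕ) :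
    L (P (n + 1) * P (n + 1)) / L (P n * P n) = gamma2 α β (n + 1) :=
  (hP.jacobi_recurrence_aux hα hβ hL n).1

theorem jacobi_recurrence (hP : IsMonicOrthSeq L P) (hα : -1 < α) (hβ : -1 < β)
    (hL : ∀ f, L ((1 - X ^ 2) * derivative f + (C (β - α) - C (α + β + 2) * X) * f) = 0) (n : ℕ) :
    X * P (n + 1) = P (n + 2) + C (gamma1 α β (n + 1)) * P (n + 1) +
      C (gamma2 α β (n + 1)) * P n :=
  (hP.jacobi_recurrence_aux hα hβ hL n).2

/-- By the Pearson equation (1 - x²) P_{n+1}' is orthogonal to `P i` for `i < n`, so only three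
terms survive; the recurrence then trades P_{n+2} for x P_{n+1}. -/
theorem jacobi_structure (hP : IsMonicOrthSeq L P) (hα : -1 < α) (hβ : -1 < β)
    (hL : ∀ f, L ((1 - X ^ 2) * derivative f + (C (β - α) - C (α + β + 2) * X) * f) = 0) (n : ℕ) :
    (1 - X ^ 2) * derivative (P (n + 1)) =
      aHat α β (n + 1) * P (n + 1) + C (bHat α β (n + 1)) * P n := by
  have hn : (0 : ℝ) ≤ n := n.cast_nonneg
  have h2 : 2 * (n : ℝ) + 2 + α + β ≠ 0 := by linarith
  set f := (1 - X ^ 2) * derivative (P (n + 1)) with hf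
  have hc (k : ℕ) : f.coeff (k + 1) =
      (k + 2) * (P (n + 1)).coeff (k + 2) - k * (P (n + 1)).coeff k :=
    coeff_one_sub_X_sq_mul_derivative _ k
  have hdeg : f.degree < ((n + 3 : ℕ) : WithBot ℕ) := by
    rw [degree_lt_iff_coeff_zero]
    intro m hm
    obtain ⟨k, rfl⟩ : ∃ k, m = k + 1 := ⟨m - 1, by omega⟩
    rw [hc, hP.coeff_of_lt (show n + 1 < k + 2 by omega), hP.coeff_of_lt (show n + 1 < k by omega)]
    simp
  have hdi (i : ℕ) : (P i).degree < ((i + 1 : ℕ) : WithBot ℕ) := by rw [hP.degree]; norm_cast; omega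
  obtain ⟨b, hb⟩ := hP.exists_three_terms hdeg fun i hi => by
    rw [hf, L_derivative_mul hL, hP.orth_of_degree_lt, neg_zero]
    exact (degree_pearson_lt (hdi i)).trans_le (by norm_cast; omega)
  -- After integration by parts only the top coefficient -(n + 2 + α + β) of the Pearson operator
  -- applied to `P n` contributes.
  have hlast : L (f * P n) = (n + 2 + α + β) * L (P (n + 1) * P (n + 1)) := by
    rw [hf, L_derivative_mul hL, hP.L_mul_of_degree_lt_succ (degree_pearson_lt (hdi n)), coeff_add,
      coeff_one_sub_X_sq_mul_derivative, sub_mul, coeff_sub, coeff_C_mul, mul_assoc, coeff_C_mul,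
      coeff_X_mul, hP.coeff_self, hP.coeff_of_lt (show n < n + 1 by omega),
      hP.coeff_of_lt (show n < n + 2 by omega)]
    ring
  have htop : f.coeff (n + 2) = -(n + 1) := by
    rw [hc, hP.coeff_self, hP.coeff_of_lt (show n + 1 < n + 1 + 2 by omega)]
    push_cast
    ring
  rw [hlast, mul_div_assoc, hP.norm_div_norm hα hβ hL, htop] at hb
  have hrec := hP.jacobi_recurrence hα hβ hL n
  have hb2 : f = C (-(n + 1) : ℝ) * X * P (n + 1) + C (b + (n + 1) * gamma1 α β (n + 1)) * P (n + 1)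
      + C (bHat α β (n + 1)) * P n := by
    -- The factor 2n + 3 + α + β is the sum of n + 2 + α + β from `hlast` and n + 1 from eliminating
    -- P_{n+2}.
    rw [bHat_eq hα hβ, hb]
    simp only [C_add, C_mul, C_neg, C_1, C_ofNat]
    linear_combination (C (n : ℝ) + 1) * hrec
  have hu : b + (n + 1) * gamma1 α β (n + 1) = (P (n + 1)).coeff n := by
    have e := congrArg (fun f => f.coeff (n + 1)) hb2
    simp only [coeff_add, coeff_C_mul, mul_assoc, coeff_X_mul, hc, hP.coeff_self,
      hP.coeff_of_lt (Nat.lt_succ_self n), hP.coeff_of_lt (show n + 1 < n + 2 by omega)] at e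
    linarith
  rw [hb2, hu, hP.coeff_pred hα hβ hL, aHat, mul_add, ← mul_assoc (C _) (C _) X, ← C_mul, ← C_mul]
  push_cast
  rw [show 2 * ((n : ℝ) + 1) + α + β = 2 * n + 2 + α + β by ring,
    div_mul_cancel₀ _ h2, div_mul_eq_mul_div,
    show -((n : ℝ) + 1) * (β - α) = (n + 1) * (α - β) by ring]
  ring

/-- For positive degree this is `jacobi_structure` with the lower neighbour replaced through the
recurrence. Degree 0 has no lower neighbour and is checked directly. -/
theorem jacobi_structure_pred (hP : IsMonicOrthSeq L P) (hα : -1 < α) (hβ : -1 < β)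
    (hL : ∀ f, L ((1 - X ^ 2) * derivative f + (C (β - α) - C (α + β + 2) * X) * f) = 0) (n : ℕ) :
    (1 - X ^ 2) * derivative (P n) =
      cHat α β (n + 1) * P n + C (dHat α β (n + 1)) * P (n + 1) := by
  rcases n with _ | n
  · have h1 : P 1 = X + C ((α - β) / (2 + α + β)) := by
      have h := (hP.monic 1).as_sum
      have hp := hP.coeff_pred hα hβ hL 0
      rw [hP.natDegree] at h
      rw [h]
      simp only [zero_add] at hp
      simp [hp]
    have h2 : 2 + α + β ≠ 0 := by linarith
    rw [hP.zero_eq_one, h1, cHat, dHat, mul_add, mul_add, ← mul_assoc (C _) (C _) X, ← C_mul,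
      ← C_mul, ← C_mul]
    simp only [zero_add, Nat.cast_one, mul_one, derivative_one, mul_zero]
    rw [div_mul_cancel₀ _ h2, div_mul_eq_mul_div, neg_mul, mul_div_assoc', show 2 + α + β - 1 =
      1 + α + β by ring]
    simp only [C_neg]
    ring
  · have hn : (0 : ℝ) ≤ n := n.cast_nonneg
    have h2 : 2 * (n : ℝ) + 2 + α + β ≠ 0 := by linarith
    have h4 : 2 * (n : ℝ) + 4 + α + β ≠ 0 := by linarith
    have hc : cHat α β (n + 1 + 1) = aHat α β (n + 1) +
        C (2 * n + 3 + α + β) * (X - C (gamma1 α β (n + 1))) := by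
      have e1 : aHat α β (n + 1) = C (-(n + 1 : ℝ)) * X +
          C ((n + 1) * (α - β) / (2 * n + 2 + α + β)) := by
        rw [aHat, mul_add, ← mul_assoc (C _) (C _) X, ← C_mul, ← C_mul]
        push_cast
        rw [show 2 * ((n : ℝ) + 1) + α + β = 2 * n + 2 + α + β by ring,
          div_mul_cancel₀ _ h2, div_mul_eq_mul_div,
          show -((n : ℝ) + 1) * (β - α) = (n + 1) * (α - β) by ring]
      have e2 : cHat α β (n + 1 + 1) = C (n + 2 + α + β) * X +
          C ((n + 2 + α + β) * (α - β) / (2 * n + 4 + α + β)) := by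
        rw [cHat, mul_add, ← mul_assoc (C _) (C _) X, ← C_mul, ← C_mul]
        push_cast
        rw [show 2 * ((n : ℝ) + 1 + 1) + α + β = 2 * n + 4 + α + β by ring,
          div_mul_cancel₀ _ h4, div_mul_eq_mul_div, show (n : ℝ) + 1 + 1 = n + 2 by ring]
      have e3 : (n + 2 + α + β) * (α - β) / (2 * n + 4 + α + β) =
          (n + 1) * (α - β) / (2 * n + 2 + α + β) -
            (2 * n + 3 + α + β) * gamma1 α β (n + 1) := by
        rw [gamma1]
        push_cast
        rw [show 2 * ((n : ℝ) + 1) + α + β = 2 * n + 2 + α + β by ring,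
          show 2 * (n : ℝ) + 2 + α + β + 2 = 2 * n + 4 + α + β by ring]
        clear e1 e2
        generalize h2' : 2 * (n : ℝ) + 2 + α + β = D2 at *
        generalize h4' : 2 * (n : ℝ) + 4 + α + β = D4 at *
        field_simp
        subst h2' h4'
        ring
      rw [e1, e2, e3]
      simp only [C_add, C_mul, C_neg, C_sub, C_1, C_ofNat]
      ring
    have hrec := hP.jacobi_recurrence hα hβ hL n
    rw [hP.jacobi_structure hα hβ hL, hc, bHat_eq hα hβ, dHat]
    push_cast
    simp only [C_add, C_mul, C_neg, C_sub, C_1, C_ofNat]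
    linear_combination (-(2 * C (n : ℝ) + 3 + C α + C β)) * hrec

end IsMonicOrthSeq

theorem isMonicOrthSeq_jacobiP {α β : ℝ} (hα : -1 < α) (hβ : -1 < β) :
    IsMonicOrthSeq (jacobiL hα hβ) (jacobiP α β) where
  pos _ hf := jacobiL_mul_self_pos hα hβ hf
  monic n := (jacobiP_spec hα hβ n).1.1
  natDegree n := natDegree_eq_of_isLowestMonicOrth (jacobiInner_add_right hα hβ)
    (jacobiInner_smul_right α β)
    (fun f g => by rw [jacobiInner_eq_jacobiL hα hβ, jacobiInner_eq_jacobiL hα hβ, mul_comm])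
    (fun f hf => by
      rw [jacobiInner_eq_jacobiL hα hβ]
      exact jacobiL_mul_self_pos hα hβ hf) (jacobiP_spec hα hβ n)
  orth n k hk := by
    rw [← jacobiInner_eq_jacobiL]
    exact (jacobiP_spec hα hβ n).1.2 k hk

/-! ### Christoffel–Darboux kernels with derivatives -/

/-- The `k`-th Taylor coefficient of a polynomial at `c`. -/
noncomputable def taylorCoeff (c : ℝ) (k : ℕ) : ℝ[X] →ₗ[ℝ] ℝ :=
  lcoeff ℝ k ∘ₗ taylor c

theorem eval_iterate_derivative (c : ℝ) (k : ℕ) (f : ℝ[X]) :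
    (derivative^[k] f).eval c = k.factorial * taylorCoeff c k f := by
  rw [← factorial_smul_hasseDeriv]
  simp [taylorCoeff, taylor_coeff]

theorem taylorQ_eq (k : ℕ) (c : ℝ) (f : ℝ[X]) :
    taylorQ k c f = ∑ ν ∈ Finset.range (k + 1), C (taylorCoeff c ν f) * (X - C c) ^ ν := by
  refine Finset.sum_congr rfl fun ν _ => ?_
  rw [eval_iterate_derivative, mul_div_cancel_left₀ _ (by positivity)]

theorem taylorCoeff_zero_X_mul (c : ℝ) (f : ℝ[X]) :
    taylorCoeff c 0 (X * f) = c * taylorCoeff c 0 f := by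
  simp [taylorCoeff, add_mul]

theorem taylorCoeff_succ_X_mul (c : ℝ) (k : ℕ) (f : ℝ[X]) :
    taylorCoeff c (k + 1) (X * f) = c * taylorCoeff c (k + 1) f + taylorCoeff c k f := by
  simp [taylorCoeff, add_mul, coeff_X_mul, add_comm]

namespace IsMonicOrthSeq

variable {L : ℝ[X] →ₗ[ℝ] ℝ} {P : ℕ → ℝ[X]}

/-- Let T_k be the k-th Taylor coefficient at `c` in the variable `y`. Since T_{k+1}(y f) = c
T_{k+1} f + T_k f, one factor `x - c` lowers the order of the kernel by one and leaves a boundary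
term; the boundary terms from all `k + 1` factors assemble into the Taylor polynomials. -/
theorem christoffel_darboux_taylor (hP : IsMonicOrthSeq L P) (c : ℝ) (n k : ℕ) :
    (X - C c) ^ (k + 1) *
        ∑ i ∈ Finset.range (n + 1), C (taylorCoeff c k (P i) / L (P i * P i)) * P i =
      C (L (P n * P n))⁻¹ *
        (taylorQ k c (P n) * P (n + 1) - taylorQ k c (P (n + 1)) * P n) := by
  simp only [taylorQ_eq]
  induction k with
  | zero =>
    have h := hP.christoffel_darboux (taylorCoeff c 0) n
    simp only [zero_add, Finset.sum_range_one, pow_zero, pow_one, mul_one]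
    rw [← h, Finset.mul_sum]
    refine Finset.sum_congr rfl fun i _ => ?_
    rw [taylorCoeff_zero_X_mul, div_eq_mul_inv, C_mul, C_mul]
    ring
  | succ k ih =>
    have h := hP.christoffel_darboux (taylorCoeff c (k + 1)) n
    have h' : (X - C c) *
        ∑ i ∈ Finset.range (n + 1), C (taylorCoeff c (k + 1) (P i) / L (P i * P i)) * P i =
        (∑ i ∈ Finset.range (n + 1), C (taylorCoeff c k (P i) / L (P i * P i)) * P i) +
        C (L (P n * P n))⁻¹ * (C (taylorCoeff c (k + 1) (P n)) * P (n + 1) -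
          C (taylorCoeff c (k + 1) (P (n + 1))) * P n) := by
      rw [← h, Finset.mul_sum, ← Finset.sum_add_distrib]
      refine Finset.sum_congr rfl fun i _ => ?_
      rw [taylorCoeff_succ_X_mul, div_eq_mul_inv, div_eq_mul_inv]
      simp only [C_mul, C_add]
      ring
    rw [Finset.sum_range_succ _ (k + 1), Finset.sum_range_succ _ (k + 1), pow_succ, mul_assoc, h',
      mul_add, ih]
    ring

end IsMonicOrthSeq

/-! ### Jacobi–Sobolev polynomials -/

namespace JacobiSobolev

variable (J : JacobiSobolev)

/-- The Jacobi functional of `J`. -/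
noncomputable def L : ℝ[X] →ₗ[ℝ] ℝ := jacobiL J.hα J.hβ

/-- The monic Jacobi polynomials of `J`. -/
noncomputable def P (n : ℕ) : ℝ[X] := jacobiP J.α J.β n

theorem isMonicOrthSeq : IsMonicOrthSeq J.L J.P := isMonicOrthSeq_jacobiP J.hα J.hβ

theorem pearson (f : ℝ[X]) : J.L ((1 - X ^ 2) * derivative f +
    (C (J.β - J.α) - C (J.α + J.β + 2) * X) * f) = 0 := jacobiL_pearson J.hα J.hβ f

theorem jacobiH_eq (n : ℕ) : jacobiH J.α J.β n = J.L (J.P n * J.P n) :=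
  jacobiInner_eq_jacobiL J.hα J.hβ _ _

/-- The discrete part of the inner product. -/
noncomputable def disc (f g : ℝ[X]) : ℝ := ∑ j : Fin J.N, ∑ k ∈ Finset.range (J.ord j + 1),
    J.lam j k * (derivative^[k] f).eval (J.c j) * (derivative^[k] g).eval (J.c j)

theorem inner_eq (f g : ℝ[X]) : J.inner f g = J.L (f * g) + J.disc f g := by
  rw [inner, jacobiInner_eq_jacobiL J.hα J.hβ]
  rfl

theorem disc_comm (f g : ℝ[X]) : J.disc f g = J.disc g f :=
  Finset.sum_congr rfl fun _ _ => Finset.sum_congr rfl fun _ _ => by ring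

theorem inner_comm (f g : ℝ[X]) : J.inner f g = J.inner g f := by
  rw [inner_eq, inner_eq, mul_comm, disc_comm]

theorem disc_add_right (f g h : ℝ[X]) : J.disc f (g + h) = J.disc f g + J.disc f h := by
  simp only [disc, iterate_map_add, eval_add, mul_add, Finset.sum_add_distrib]

theorem disc_smul_right (a : ℝ) (f g : ℝ[X]) : J.disc f (C a * g) = a * J.disc f g := by
  simp only [disc, iterate_derivative_C_mul, eval_mul, eval_C, Finset.mul_sum]
  refine Finset.sum_congr rfl fun j _ => Finset.sum_congr rfl fun k _ => ?_
  ring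

theorem disc_self_nonneg (f : ℝ[X]) : 0 ≤ J.disc f f := by
  refine Finset.sum_nonneg fun j _ => Finset.sum_nonneg fun k hk => ?_
  rw [mul_assoc]
  exact mul_nonneg (J.lam_nonneg j k (Nat.lt_succ_iff.1 (Finset.mem_range.1 hk)))
    (mul_self_nonneg _)

theorem inner_add_right (f g h : ℝ[X]) : J.inner f (g + h) = J.inner f g + J.inner f h := by
  simp only [inner_eq, mul_add, map_add, disc_add_right]
  ring

theorem inner_smul_right (a : ℝ) (f g : ℝ[X]) : J.inner f (C a * g) = a * J.inner f g := by
  rw [inner_eq, inner_eq, disc_smul_right, mul_left_comm, IsMonicOrthSeq.L_C_mul]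
  ring

theorem S_monic (n : ℕ) : (J.S n).Monic := (J.S_spec n).1.1

theorem S_natDegree (n : ℕ) : (J.S n).natDegree = n :=
  natDegree_eq_of_isLowestMonicOrth J.inner_add_right J.inner_smul_right J.inner_comm
    (fun f hf => by
      rw [inner_eq]
      exact add_pos_of_pos_of_nonneg (J.isMonicOrthSeq.pos f hf) (J.disc_self_nonneg f))
    (J.S_spec n)

theorem inner_S_of_degree_lt {n : ℕ} {f : ℝ[X]} (hf : f.degree < n) : J.inner (J.S n) f = 0 := by
  let φ : ℝ[X] →ₗ[ℝ] ℝ :=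
    { toFun := J.inner (J.S n)
      map_add' := J.inner_add_right _
      map_smul' := fun a g => by simp [smul_eq_C_mul, inner_smul_right] }
  change φ f = 0
  rw [f.as_sum_range_C_mul_X_pow, map_sum]
  refine Finset.sum_eq_zero fun i _ => ?_
  rw [← smul_eq_C_mul, map_smul, smul_eq_mul]
  rcases lt_or_ge i n with hi | hi
  · have : φ (X ^ i) = 0 := by
      change J.inner (J.S n) (X ^ i) = 0
      rw [inner_comm]
      exact (J.S_spec n).1.2 i hi
    rw [this, mul_zero]
  · rw [coeff_eq_zero_of_degree_lt (hf.trans_le (by exact_mod_cast hi)), zero_mul]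

theorem degree_S_sub_P (n : ℕ) : (J.S n - J.P n).degree < n := by
  have hc : (J.S n).coeff n = 1 := by
    have := J.S_monic n
    rwa [Monic, leadingCoeff, S_natDegree] at this
  have hd : (J.S n).degree < ((n + 1 : ℕ) : WithBot ℕ) := by
    rw [degree_eq_natDegree (J.S_monic n).ne_zero, S_natDegree]
    norm_cast
    omega
  simpa [hc] using J.isMonicOrthSeq.degree_sub_lt hd

/-- The number `k! λ_{j,k} S_n^{(k)}(c_j)`. -/
noncomputable def mass (n : ℕ) (j : Fin J.N) (k : ℕ) : ℝ :=
  (k.factorial : ℝ) * J.lam j k * (derivative^[k] (J.S n)).eval (J.c j)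

theorem disc_S (n : ℕ) (f : ℝ[X]) : J.disc (J.S n) f =
    ∑ j : Fin J.N, ∑ k ∈ Finset.range (J.ord j + 1), J.mass n j k * taylorCoeff (J.c j) k f := by
  refine Finset.sum_congr rfl fun j _ => Finset.sum_congr rfl fun k _ => ?_
  rw [eval_iterate_derivative _ _ f, mass]
  ring

theorem weight_succ (n : ℕ) (j : Fin J.N) (k : ℕ) :
    J.weight (n + 1) j k = J.mass (n + 1) j k * (J.L (J.P n * J.P n))⁻¹ := by
  rw [weight, mass, Nat.add_sub_cancel, jacobiH_eq, div_eq_mul_inv]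

theorem S_expansion (n : ℕ) : J.S n = J.P n - ∑ j : Fin J.N, ∑ k ∈ Finset.range (J.ord j + 1),
    C (J.mass n j k) * ∑ i ∈ Finset.range n,
      C (taylorCoeff (J.c j) k (J.P i) / J.L (J.P i * J.P i)) * J.P i := by
  have hP := J.isMonicOrthSeq
  have h := hP.expansion (J.degree_S_sub_P n)
  rw [sub_eq_iff_eq_add] at h
  rw [eq_sub_iff_add_eq]
  conv_lhs => rw [h]
  rw [add_right_comm, add_eq_right]
  simp only [Finset.mul_sum]
  have hswap : ∀ j : Fin J.N, (∑ k ∈ Finset.range (J.ord j + 1), ∑ i ∈ Finset.range n,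
      C (J.mass n j k) * (C (taylorCoeff (J.c j) k (J.P i) / J.L (J.P i * J.P i)) * J.P i)) =
      ∑ i ∈ Finset.range n, ∑ k ∈ Finset.range (J.ord j + 1),
      C (J.mass n j k) * (C (taylorCoeff (J.c j) k (J.P i) / J.L (J.P i * J.P i)) * J.P i) :=
    fun j => Finset.sum_comm
  rw [Finset.sum_congr rfl fun j _ => hswap j, Finset.sum_comm, ← Finset.sum_add_distrib]
  refine Finset.sum_eq_zero fun i hi => ?_
  have hi := Finset.mem_range.1 hi
  -- Orthogonality to `P i` turns the Fourier coefficient of `S n` at `P i` into minus the discrete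
  -- part, which is a combination of Taylor coefficients of `P i`.
  have h0 := J.inner_S_of_degree_lt (n := n) (f := J.P i)
    (by rw [hP.degree]; exact_mod_cast hi)
  rw [inner_eq, disc_S] at h0
  have h1 : J.L ((J.S n - J.P n) * J.P i) = J.L (J.S n * J.P i) := by
    rw [sub_mul, map_sub, hP.orth_of_ne hi.ne', sub_zero]
  have h2 : ∑ j : Fin J.N, ∑ k ∈ Finset.range (J.ord j + 1),
      C (J.mass n j k) * (C (taylorCoeff (J.c j) k (J.P i) / J.L (J.P i * J.P i)) * J.P i) =
      C ((∑ j : Fin J.N, ∑ k ∈ Finset.range (J.ord j + 1),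
        J.mass n j k * taylorCoeff (J.c j) k (J.P i)) / J.L (J.P i * J.P i)) * J.P i := by
    simp only [Finset.sum_div, map_sum, Finset.sum_mul, mul_div_assoc, C_mul, mul_assoc]
  rw [h1, h2, ← add_mul, ← C_add, ← add_div, h0, zero_div, C_0, zero_mul]

theorem rho_eq (j : Fin J.N) {k : ℕ} (hk : k ≤ J.ord j) :
    J.rho = (X - C (J.c j)) ^ (k + 1) * J.rhoJK j k := by
  rw [rho, rhoJK, ← Finset.mul_prod_erase _ _ (Finset.mem_univ j), ← mul_assoc, ← pow_add]
  congr 2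
  omega

/-- The connection formula between Jacobi–Sobolev and Jacobi polynomials. -/
theorem rho_mul_S (n : ℕ) :
    J.rho * J.S (n + 1) = J.A2 (n + 1) * J.P (n + 1) + J.B2 (n + 1) * J.P n := by
  have hP := J.isMonicOrthSeq
  have key : J.rho * ∑ j : Fin J.N, ∑ k ∈ Finset.range (J.ord j + 1),
      C (J.mass (n + 1) j k) * ∑ i ∈ Finset.range (n + 1),
        C (taylorCoeff (J.c j) k (J.P i) / J.L (J.P i * J.P i)) * J.P i =
      (∑ j : Fin J.N, ∑ k ∈ Finset.range (J.ord j + 1),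
        C (J.weight (n + 1) j k) * taylorQ k (J.c j) (J.P n) * J.rhoJK j k) * J.P (n + 1) -
      (∑ j : Fin J.N, ∑ k ∈ Finset.range (J.ord j + 1),
        C (J.weight (n + 1) j k) * taylorQ k (J.c j) (J.P (n + 1)) * J.rhoJK j k) * J.P n := by
    rw [Finset.mul_sum, Finset.sum_mul, Finset.sum_mul, ← Finset.sum_sub_distrib]
    refine Finset.sum_congr rfl fun j _ => ?_
    rw [Finset.mul_sum, Finset.sum_mul, Finset.sum_mul, ← Finset.sum_sub_distrib]
    refine Finset.sum_congr rfl fun k hk => ?_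
    have h := hP.christoffel_darboux_taylor (J.c j) n k
    rw [weight_succ, J.rho_eq j (Nat.lt_succ_iff.1 (Finset.mem_range.1 hk)), C_mul]
    linear_combination C (J.mass (n + 1) j k) * J.rhoJK j k * h
  conv_lhs => rw [S_expansion, mul_sub, key]
  rw [A2, B2, Nat.add_sub_cancel]
  change _ = (J.rho - (∑ j : Fin J.N, ∑ k ∈ Finset.range (J.ord j + 1),
        C (J.weight (n + 1) j k) * taylorQ k (J.c j) (J.P n) * J.rhoJK j k)) * J.P (n + 1) +
      (∑ j : Fin J.N, ∑ k ∈ Finset.range (J.ord j + 1),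
        C (J.weight (n + 1) j k) * taylorQ k (J.c j) (J.P (n + 1)) * J.rhoJK j k) * J.P n
  ring

/-- The coefficient of `x ^ (d - 1)` in `B_{2,n}`. -/
noncomputable def sigma (n : ℕ) : ℝ := ∑ j : Fin J.N, ∑ k ∈ Finset.range (J.ord j + 1),
  J.weight n j k * taylorCoeff (J.c j) k (J.P n)

/-- With S = S_{n+1}, p = P_{n+1} and D the discrete form, orthogonality of S to S - p gives D(S, p)
= D(S, S) + L((S - p)²), which is nonnegative; σ is this number divided by h_n. -/
theorem sigma_nonneg (n : ℕ) : 0 ≤ J.sigma (n + 1) := by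
  have hP := J.isMonicOrthSeq
  set S := J.S (n + 1)
  set p := J.P (n + 1)
  have h1 : J.sigma (n + 1) = J.disc S p * (J.L (J.P n * J.P n))⁻¹ := by
    rw [disc_S, sigma]
    simp only [weight_succ, Finset.sum_mul]
    exact Finset.sum_congr rfl fun j _ => Finset.sum_congr rfl fun k _ => by ring
  have hdeg := J.degree_S_sub_P (n + 1)
  have h2 : J.inner S (S - p) = 0 := J.inner_S_of_degree_lt hdeg
  have h3 : J.L ((S - p) * p) = 0 := hP.orth_of_degree_lt hdeg
  have h4 : 0 ≤ J.L ((S - p) * (S - p)) := by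
    rcases eq_or_ne (S - p) 0 with h | h
    · simp [h]
    · exact (hP.pos _ h).le
  have h5 : J.disc S S = J.disc S (S - p) + J.disc S p := by
    rw [← disc_add_right, sub_add_cancel]
  have h6 : J.L (S * (S - p)) = J.L ((S - p) * (S - p)) + J.L ((S - p) * p) := by
    rw [← map_add]
    congr 1
    ring
  rw [inner_eq] at h2
  rw [h1]
  refine mul_nonneg ?_ (inv_nonneg.2 (hP.norm_pos n).le)
  linarith [J.disc_self_nonneg S]

end JacobiSobolev

/-! ### Formal leading coefficients -/

/-- `p` has degree at most `m`, and `a` is its coefficient at `x ^ m`. -/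
def HasLead (p : ℝ[X]) (m : ℕ) (a : ℝ) : Prop := p.natDegree ≤ m ∧ p.coeff m = a

namespace HasLead

variable {p q : ℝ[X]} {m k : ℕ} {a b : ℝ}

theorem cast (h : HasLead p m a) (hm : m = k) (ha : a = b) : HasLead p k b := hm ▸ ha ▸ h

theorem add (hp : HasLead p m a) (hq : HasLead q m b) : HasLead (p + q) m (a + b) :=
  ⟨natDegree_add_le_of_degree_le hp.1 hq.1, by rw [coeff_add, hp.2, hq.2]⟩

theorem neg (hp : HasLead p m a) : HasLead (-p) m (-a) :=
  ⟨by rw [natDegree_neg]; exact hp.1, by rw [coeff_neg, hp.2]⟩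

theorem sub (hp : HasLead p m a) (hq : HasLead q m b) : HasLead (p - q) m (a - b) := by
  rw [sub_eq_add_neg, sub_eq_add_neg]
  exact hp.add hq.neg

theorem mul (hp : HasLead p m a) (hq : HasLead q k b) : HasLead (p * q) (m + k) (a * b) :=
  ⟨natDegree_mul_le_of_le hp.1 hq.1, by
    rw [coeff_mul_add_eq_of_natDegree_le hp.1 hq.1, hp.2, hq.2]⟩

theorem const_mul (hp : HasLead p m a) (c : ℝ) : HasLead (C c * p) m (c * a) :=
  ⟨(natDegree_C_mul_le _ _).trans hp.1, by rw [coeff_C_mul, hp.2]⟩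

theorem X_mul (hp : HasLead p m a) : HasLead (X * p) (m + 1) a :=
  ⟨(natDegree_mul_le_of_le natDegree_X_le hp.1).trans (by omega), by rw [coeff_X_mul, hp.2]⟩

/-- `B2` and `C2` have degree at most `d - 1`, which is awkward in ℕ when `d = 0`. Degrees are
therefore counted after multiplication by `X`, and the factor is removed at the end. -/
theorem of_X_mul (hp : HasLead (X * p) (m + 1) a) : HasLead p m a := by
  refine ⟨?_, by rw [← hp.2, coeff_X_mul]⟩
  rcases eq_or_ne p 0 with rfl | h0
  · simp
  · have := hp.1
    rw [natDegree_X_mul h0] at this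
    omega

/-- Used to drop lower-order terms: they enter the sum at the common degree with coefficient 0. -/
theorem succ (hp : HasLead p m a) : HasLead p (m + 1) 0 :=
  ⟨hp.1.trans (by omega), coeff_eq_zero_of_natDegree_lt (Nat.lt_succ_of_le hp.1)⟩

theorem X_mul_derivative (hp : HasLead p m a) : HasLead (X * derivative p) m (m * a) := by
  constructor
  · rcases m with _ | m
    · rw [natDegree_eq_zero.1 (Nat.le_zero.1 hp.1) |>.choose_spec.symm]
      simp
    · exact natDegree_mul_le_of_le natDegree_X_le (natDegree_derivative_le _) |>.trans
        (by have := hp.1; omega)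
  · rcases m with _ | m
    · simp
    · rw [coeff_X_mul, coeff_derivative, hp.2]
      push_cast
      ring

theorem of_monic (hp : p.Monic) : HasLead p p.natDegree 1 := ⟨le_rfl, hp⟩

theorem of_monic_mul (hq : q.Monic) (h : HasLead (q * p) (q.natDegree + m) a) :
    HasLead p m a := by
  have hp : HasLead p m (p.coeff m) := by
    refine ⟨?_, rfl⟩
    rcases eq_or_ne p 0 with rfl | h0
    · simp
    · have := h.1
      rw [natDegree_mul hq.ne_zero h0] at this
      omega
  refine hp.cast rfl ?_
  rw [← ((of_monic hq).mul hp).2.trans (one_mul _), h.2]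

theorem sum {ι : Type*} {s : Finset ι} {f : ι → ℝ[X]} {c : ι → ℝ}
    (h : ∀ i ∈ s, HasLead (f i) m (c i)) : HasLead (∑ i ∈ s, f i) m (∑ i ∈ s, c i) :=
  ⟨natDegree_sum_le_of_forall_le _ _ fun i hi => (h i hi).1, by
    rw [finsetSum_coeff]
    exact Finset.sum_congr rfl fun i hi => (h i hi).2⟩

theorem one_sub_X_sq : HasLead (1 - X ^ 2) 2 (-1) :=
  ⟨by compute_degree, by simp [coeff_one]⟩

theorem linear (a b : ℝ) : HasLead (C a * X + C b) 1 a :=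
  ⟨natDegree_linear_le, by simp⟩

theorem degree_eq (h : HasLead p m a) (ha : a ≠ 0) : p.degree = ((m : ℕ) : WithBot ℕ) := by
  have hc : p.coeff m ≠ 0 := by rw [h.2]; exact ha
  exact le_antisymm (degree_le_of_natDegree_le h.1) (le_degree_of_ne_zero hc)

end HasLead

/-! ### Top coefficients and exact degrees of the ladder polynomials. -/

namespace JacobiSobolev

variable (J : JacobiSobolev)

theorem rho_monic : J.rho.Monic :=
  monic_prod_of_monic _ _ fun _ _ => (monic_X_sub_C _).pow _

theorem rho_natDegree : J.rho.natDegree = J.d := by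
  rw [rho, natDegree_prod_of_monic _ _ fun j _ => (monic_X_sub_C _).pow _, d]
  exact Finset.sum_congr rfl fun j _ => by rw [natDegree_pow, natDegree_X_sub_C, mul_one]

theorem rho_hasLead : HasLead J.rho J.d 1 := by
  rw [← rho_natDegree]
  exact HasLead.of_monic J.rho_monic

theorem taylorQ_hasLead (k : ℕ) (c : ℝ) (f : ℝ[X]) :
    HasLead (taylorQ k c f) k (taylorCoeff c k f) := by
  have hpow (ν : ℕ) : HasLead ((X - C c) ^ ν) ν 1 :=
    (HasLead.of_monic ((monic_X_sub_C c).pow ν)).cast (by rw [natDegree_pow, natDegree_X_sub_C, mul_one]) rfl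
  rw [taylorQ_eq, Finset.sum_range_succ]
  have h0 : HasLead (∑ ν ∈ Finset.range k, C (taylorCoeff c ν f) * (X - C c) ^ ν) k 0 := by
    refine (HasLead.sum (c := fun _ => 0) fun ν hν => ?_).cast rfl Finset.sum_const_zero
    have hν := Finset.mem_range.1 hν
    have h := ((hpow ν).const_mul (taylorCoeff c ν f)).1
    exact ⟨h.trans hν.le, coeff_eq_zero_of_natDegree_lt (h.trans_lt hν)⟩
  exact (h0.add ((hpow k).const_mul _)).cast rfl (by ring)

theorem taylorQ_mul_rhoJK_hasLead (j : Fin J.N) {k : ℕ} (hk : k ≤ J.ord j) (f : ℝ[X]) :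
    HasLead (X * (taylorQ k (J.c j) f * J.rhoJK j k)) J.d (taylorCoeff (J.c j) k f) := by
  have hpow := (monic_X_sub_C (J.c j)).pow (k + 1)
  have h : HasLead (J.rhoJK j k) (J.d - (k + 1)) 1 := by
    have hmon : (J.rhoJK j k).Monic := by
      refine hpow.of_mul_monic_left ?_
      rw [← J.rho_eq j hk]
      exact J.rho_monic
    refine (HasLead.of_monic hmon).cast ?_ rfl
    rw [← rho_natDegree, J.rho_eq j hk, hpow.natDegree_mul hmon, natDegree_pow, natDegree_X_sub_C, mul_one]
    omega
  have hd : k + 1 ≤ J.d :=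
    (Nat.succ_le_succ hk).trans
      (Finset.single_le_sum (f := fun i => J.ord i + 1) (fun _ _ => Nat.zero_le _)
        (Finset.mem_univ j))
  exact ((taylorQ_hasLead k (J.c j) f).mul h).X_mul.cast (by omega) (mul_one _)

theorem sum_taylorQ_hasLead (w : Fin J.N → ℕ → ℝ) (f : ℝ[X]) :
    HasLead (X * ∑ j : Fin J.N, ∑ k ∈ Finset.range (J.ord j + 1),
      C (w j k) * taylorQ k (J.c j) f * J.rhoJK j k) J.d
      (∑ j : Fin J.N, ∑ k ∈ Finset.range (J.ord j + 1), w j k * taylorCoeff (J.c j) k f) := by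
  rw [Finset.mul_sum]
  refine HasLead.sum fun j _ => ?_
  rw [Finset.mul_sum]
  refine HasLead.sum fun k hk => ?_
  rw [mul_assoc, mul_left_comm]
  exact (J.taylorQ_mul_rhoJK_hasLead j (Nat.lt_succ_iff.1 (Finset.mem_range.1 hk)) f).const_mul _

theorem X_mul_B2_hasLead (n : ℕ) : HasLead (X * J.B2 n) J.d (J.sigma n) :=
  J.sum_taylorQ_hasLead (J.weight n) (J.P n)

theorem A2_hasLead (n : ℕ) : HasLead (J.A2 n) J.d 1 := by
  apply HasLead.of_X_mul
  rw [A2, mul_sub]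
  exact (J.rho_hasLead.X_mul.sub (J.sum_taylorQ_hasLead _ _).succ).cast rfl (sub_zero _)

theorem A3_hasLead (n : ℕ) : HasLead (J.A3 (n + 1)) (J.d + 1) (-(J.d + n + 1)) := by
  have hn : (0 : ℝ) ≤ n := n.cast_nonneg
  have hα := J.hα
  have hβ := J.hβ
  have hA := J.A2_hasLead (n + 1)
  have h1 := hA.X_mul_derivative.mul HasLead.one_sub_X_sq
  have h2 := (((HasLead.linear (2 * (n + 1 : ℕ) + J.α + J.β) (J.β - J.α)).const_mul
    (-((n + 1 : ℕ) : ℝ) / (2 * (n + 1 : ℕ) + J.α + J.β))).mul hA).X_mul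
  have h3 := ((J.X_mul_B2_hasLead (n + 1)).const_mul (dHat J.α J.β (n + 1))).succ.succ
  apply HasLead.of_X_mul
  have h : X * J.A3 (n + 1) = X * derivative (J.A2 (n + 1)) * (1 - X ^ 2) +
      X * (aHat J.α J.β (n + 1) * J.A2 (n + 1)) +
      C (dHat J.α J.β (n + 1)) * (X * J.B2 (n + 1)) := by
    rw [A3]
    ring
  rw [h]
  refine ((h1.add (h2.cast (by omega) rfl)).add h3).cast rfl ?_
  push_cast
  rw [div_mul_cancel₀ _ (by linarith)]
  ring

theorem B3_hasLead (n : ℕ) : HasLead (J.B3 (n + 1)) J.d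
    (bHat J.α J.β (n + 1) + (n + 2 + J.α + J.β - J.d) * J.sigma (n + 1)) := by
  have hn : (0 : ℝ) ≤ n := n.cast_nonneg
  have hα := J.hα
  have hβ := J.hβ
  have hB := J.X_mul_B2_hasLead (n + 1)
  have h1 := HasLead.one_sub_X_sq.mul (hB.X_mul_derivative.sub hB)
  have h2 := (J.A2_hasLead (n + 1)).X_mul.X_mul.const_mul (bHat J.α J.β (n + 1))
  have h3 := (((HasLead.linear (2 * (n + 1 : ℕ) + J.α + J.β) (J.α - J.β)).const_mul
    ((((n + 1 : ℕ) : ℝ) + J.α + J.β) / (2 * (n + 1 : ℕ) + J.α + J.β))).mul hB).X_mul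
  -- Two factors `X` are needed since X² B₂' = X (X B₂)' - X B₂ involves only the product `X * B2`,
  -- whose top coefficient is known.
  apply HasLead.of_X_mul
  apply HasLead.of_X_mul
  have h : X * (X * J.B3 (n + 1)) =
      (1 - X ^ 2) * (X * derivative (X * J.B2 (n + 1)) - X * J.B2 (n + 1)) +
      C (bHat J.α J.β (n + 1)) * (X * (X * J.A2 (n + 1))) +
      X * (cHat J.α J.β (n + 1) * (X * J.B2 (n + 1))) := by
    rw [B3, derivative_mul, derivative_X]
    ring
  rw [h]
  refine (((h1.cast (by omega) rfl).add h2).add (h3.cast (by omega) rfl)).cast rfl ?_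
  push_cast
  rw [div_mul_cancel₀ _ (by linarith)]
  ring

/-- The leading coefficient of `Δ_{n + 1}`. -/
noncomputable def kappa (n : ℕ) : ℝ := 1 + J.sigma n * (gamma2 J.α J.β n)⁻¹

theorem kappa_pos (n : ℕ) : 0 < J.kappa (n + 1) :=
  add_pos_of_pos_of_nonneg one_pos (mul_nonneg (J.sigma_nonneg n)
    (inv_nonneg.2 (IsMonicOrthSeq.gamma2_pos J.hα J.hβ n).le))

theorem recFactor_hasLead (n : ℕ) :
    HasLead (J.recFactor (n + 1)) 1 (gamma2 J.α J.β n)⁻¹ := by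
  rw [recFactor, Nat.add_sub_cancel]
  exact ((HasLead.of_monic (monic_X_sub_C _)).const_mul _).cast (natDegree_X_sub_C _) (mul_one _)

theorem X_mul_C2_hasLead (n : ℕ) : HasLead (X * J.C2 (n + 1)) J.d
    (-((gamma2 J.α J.β n)⁻¹ * J.sigma n)) := by
  rw [C2, Nat.add_sub_cancel, mul_neg, mul_left_comm]
  exact ((J.X_mul_B2_hasLead n).const_mul _).neg

theorem D2_hasLead (n : ℕ) : HasLead (J.D2 (n + 1)) J.d (J.kappa n) := by
  apply HasLead.of_X_mul
  rw [D2, Nat.add_sub_cancel, mul_add, ← mul_assoc]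
  exact (J.A2_hasLead n).X_mul.add ((J.X_mul_B2_hasLead n).mul (J.recFactor_hasLead n))

theorem C3_hasLead (n : ℕ) : HasLead (J.C3 (n + 2)) J.d
    (-((gamma2 J.α J.β (n + 1))⁻¹ *
      (bHat J.α J.β (n + 1) + (n + 2 + J.α + J.β - J.d) * J.sigma (n + 1)))) :=
  ((J.B3_hasLead n).const_mul _).neg

theorem D3_hasLead (n : ℕ) : HasLead (J.D3 (n + 2)) (J.d + 1)
    ((n + 2 + J.α + J.β - J.d) * J.kappa (n + 1)) := by
  have hg := (IsMonicOrthSeq.gamma2_pos J.hα J.hβ n).ne'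
  refine ((J.A3_hasLead n).add ((J.B3_hasLead n).mul (J.recFactor_hasLead (n + 1)))).cast rfl ?_
  -- Dividing b̂ by γ₂ adds 2n + 3 + α + β to -(d + n + 1), giving the same factor n + 2 + α + β - d
  -- that multiplies σ, so κ splits off.
  rw [IsMonicOrthSeq.bHat_eq J.hα J.hβ, kappa]
  field_simp
  ring

theorem Delta_hasLead (n : ℕ) : HasLead (J.Delta (n + 1)) (J.d + J.d) (J.kappa n) := by
  apply HasLead.of_X_mul
  apply HasLead.of_X_mul
  have h : X * (X * J.Delta (n + 1)) = X * (X * (J.A2 (n + 1) * J.D2 (n + 1))) -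
      X * J.C2 (n + 1) * (X * J.B2 (n + 1)) := by
    rw [Delta]
    ring
  rw [h]
  exact ((((J.A2_hasLead _).mul (J.D2_hasLead n)).X_mul.X_mul).sub
    ((J.X_mul_C2_hasLead n).mul (J.X_mul_B2_hasLead _)).succ.succ).cast rfl (by ring)

theorem q0_degree (n : ℕ) : (J.q0 (n + 2)).degree = ((2 * J.d + 2 : ℕ) : WithBot ℕ) :=
  ((HasLead.one_sub_X_sq.mul (J.Delta_hasLead (n + 1))).cast (by omega) rfl).degree_eq
    (mul_ne_zero (by norm_num) (J.kappa_pos n).ne')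

theorem q1_degree (n : ℕ) : (J.q1 (n + 1)).degree = ((2 * J.d : ℕ) : WithBot ℕ) := by
  have h : X * J.q1 (n + 1) = X * (J.B3 (n + 1) * J.A2 (n + 1)) -
      J.A3 (n + 1) * (X * J.B2 (n + 1)) := by
    rw [q1]
    ring
  have hl := ((J.B3_hasLead n).mul (J.A2_hasLead (n + 1))).X_mul.sub
    (((J.A3_hasLead n).mul (J.X_mul_B2_hasLead (n + 1))).cast (by omega) rfl)
  rw [← h] at hl
  refine (hl.of_X_mul.cast (by omega) rfl).degree_eq ?_
  have hn : (0 : ℝ) ≤ n := n.cast_nonneg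
  have hα := J.hα
  have hβ := J.hβ
  have hs := J.sigma_nonneg n
  have hg := IsMonicOrthSeq.gamma2_pos J.hα J.hβ n
  -- The top coefficient: the contributions ∓d σ of `B3` and `A3` cancel.
  have : 0 < (2 * n + 3 + J.α + J.β) * (gamma2 J.α J.β (n + 1) + J.sigma (n + 1)) :=
    mul_pos (by linarith) (by linarith)
  refine ne_of_eq_of_ne ?_ this.ne'
  rw [IsMonicOrthSeq.bHat_eq J.hα J.hβ]
  ring

theorem q4_degree (n : ℕ) : (J.q4 (n + 2)).degree = ((2 * J.d : ℕ) : WithBot ℕ) := by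
  have h : X * J.q4 (n + 2) = X * (J.C3 (n + 2) * J.D2 (n + 2)) -
      J.D3 (n + 2) * (X * J.C2 (n + 2)) := by
    rw [q4]
    ring
  have hl := ((J.C3_hasLead n).mul (J.D2_hasLead (n + 1))).X_mul.sub
    (((J.D3_hasLead n).mul (J.X_mul_C2_hasLead (n + 1))).cast (by omega) rfl)
  rw [← h] at hl
  refine (hl.of_X_mul.cast (by omega) rfl).degree_eq ?_
  have hn : (0 : ℝ) ≤ n := n.cast_nonneg
  have hα := J.hα
  have hβ := J.hβ
  have hg := (IsMonicOrthSeq.gamma2_pos J.hα J.hβ n).ne'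
  -- Up to sign this is the top coefficient: the σ-terms of `C3 * D2` and `D3 * C2` cancel and only
  -- b̂ κ / γ₂ remains.
  have : 0 < (2 * n + 3 + J.α + J.β) * J.kappa (n + 1) := mul_pos (by linarith) (J.kappa_pos n)
  refine ne_of_eq_of_ne ?_ (neg_ne_zero.2 this.ne')
  rw [IsMonicOrthSeq.bHat_eq J.hα J.hβ]
  field_simp
  ring

theorem delta_hasLead {n : ℕ} (hn : J.Delta (n + 1) = J.rho * J.delta (n + 1)) :
    HasLead (J.delta (n + 1)) J.d (J.kappa n) := by
  refine HasLead.of_monic_mul J.rho_monic ?_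
  rw [← hn, rho_natDegree]
  exact J.Delta_hasLead n

theorem X_mul_rho_delta_hasLead {n : ℕ} (hn : J.Delta (n + 1) = J.rho * J.delta (n + 1)) :
    HasLead (X * ((1 - X ^ 2) * derivative J.rho * J.delta (n + 1))) (2 * J.d + 2)
      (-(J.d * J.kappa n)) := by
  have h : X * ((1 - X ^ 2) * derivative J.rho * J.delta (n + 1)) =
      (1 - X ^ 2) * (X * derivative J.rho) * J.delta (n + 1) := by ring
  rw [h]
  exact ((HasLead.one_sub_X_sq.mul J.rho_hasLead.X_mul_derivative).mul
    (J.delta_hasLead hn)).cast (by omega) (by ring)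

theorem q2_degree {n : ℕ} (hn : J.Delta (n + 2) = J.rho * J.delta (n + 2)) :
    (J.q2 (n + 2)).degree = ((2 * J.d + 1 : ℕ) : WithBot ℕ) := by
  have h : X * J.q2 (n + 2) = X * ((1 - X ^ 2) * derivative J.rho * J.delta (n + 2)) +
      J.B3 (n + 2) * (X * J.C2 (n + 2)) - X * (J.A3 (n + 2) * J.D2 (n + 2)) := by
    rw [q2]
    ring
  have hl := ((J.X_mul_rho_delta_hasLead hn).add
    (((J.B3_hasLead (n + 1)).mul (J.X_mul_C2_hasLead (n + 1))).succ.succ.cast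
      (by omega) rfl)).sub
    (((J.A3_hasLead (n + 1)).mul (J.D2_hasLead (n + 1))).X_mul.cast (by omega) rfl)
  rw [← h] at hl
  refine hl.of_X_mul.degree_eq ?_
  -- The term with ρ'δ contributes -d κ, which removes `d` from the contribution (d + n + 2) κ of
  -- -A₃ D₂.
  have : 0 < ((n : ℝ) + 2) * J.kappa (n + 1) := mul_pos (by positivity) (J.kappa_pos n)
  refine ne_of_eq_of_ne ?_ this.ne'
  push_cast
  ring

theorem q3_degree {n : ℕ} (hn : J.Delta (n + 2) = J.rho * J.delta (n + 2)) :
    (J.q3 (n + 2)).degree = ((2 * J.d + 1 : ℕ) : WithBot ℕ) := by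
  have h : X * J.q3 (n + 2) = X * ((1 - X ^ 2) * derivative J.rho * J.delta (n + 2)) +
      J.C3 (n + 2) * (X * J.B2 (n + 2)) - X * (J.D3 (n + 2) * J.A2 (n + 2)) := by
    rw [q3]
    ring
  have hl := ((J.X_mul_rho_delta_hasLead hn).add
    (((J.C3_hasLead n).mul (J.X_mul_B2_hasLead (n + 2))).succ.succ.cast
      (by omega) rfl)).sub
    (((J.D3_hasLead n).mul (J.A2_hasLead (n + 2))).X_mul.cast (by omega) rfl)
  rw [← h] at hl
  refine hl.of_X_mul.degree_eq ?_
  have hn : (0 : ℝ) ≤ n := n.cast_nonneg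
  have hα := J.hα
  have hβ := J.hβ
  have : 0 < (n + 2 + J.α + J.β) * J.kappa (n + 1) := mul_pos (by linarith) (J.kappa_pos n)
  refine ne_of_eq_of_ne ?_ (neg_ne_zero.2 this.ne')
  ring

/-! ### Ladder equations -/

theorem derivative_rho_mul_S (n : ℕ) : (1 - X ^ 2) * derivative (J.rho * J.S (n + 1)) =
    J.A3 (n + 1) * J.P (n + 1) + J.B3 (n + 1) * J.P n := by
  have hP := J.isMonicOrthSeq
  have h1 := hP.jacobi_structure J.hα J.hβ J.pearson n
  have h2 := hP.jacobi_structure_pred J.hα J.hβ J.pearson n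
  rw [rho_mul_S, A3, B3, derivative_add, derivative_mul, derivative_mul]
  linear_combination J.A2 (n + 1) * h1 + J.B2 (n + 1) * h2

theorem P_eq (n : ℕ) :
    J.P n = J.recFactor (n + 2) * J.P (n + 1) - C (gamma2 J.α J.β (n + 1))⁻¹ * J.P (n + 2) := by
  have h := J.isMonicOrthSeq.jacobi_recurrence J.hα J.hβ J.pearson n
  have hg : C (gamma2 J.α J.β (n + 1))⁻¹ * C (gamma2 J.α J.β (n + 1)) = (1 : ℝ[X]) := by
    rw [← C_mul, inv_mul_cancel₀ (IsMonicOrthSeq.gamma2_pos J.hα J.hβ n).ne', C_1]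
  change _ = C (gamma2 J.α J.β (n + 1))⁻¹ * (X - C (gamma1 J.α J.β (n + 1))) * J.P (n + 1) - _
  linear_combination -C (gamma2 J.α J.β (n + 1))⁻¹ * h - J.P n * hg

theorem rho_mul_S_pred (n : ℕ) :
    J.rho * J.S (n + 1) = J.C2 (n + 2) * J.P (n + 2) + J.D2 (n + 2) * J.P (n + 1) := by
  change _ = -(C (gamma2 J.α J.β (n + 1))⁻¹ * J.B2 (n + 1)) * J.P (n + 2) +
    (J.A2 (n + 1) + J.B2 (n + 1) * J.recFactor (n + 2)) * J.P (n + 1)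
  rw [rho_mul_S]
  linear_combination J.B2 (n + 1) * J.P_eq n

theorem derivative_rho_mul_S_pred (n : ℕ) : (1 - X ^ 2) * derivative (J.rho * J.S (n + 1)) =
    J.C3 (n + 2) * J.P (n + 2) + J.D3 (n + 2) * J.P (n + 1) := by
  change _ = -(C (gamma2 J.α J.β (n + 1))⁻¹ * J.B3 (n + 1)) * J.P (n + 2) +
    (J.A3 (n + 1) + J.B3 (n + 1) * J.recFactor (n + 2)) * J.P (n + 1)
  rw [derivative_rho_mul_S]
  linear_combination J.B3 (n + 1) * J.P_eq n

/-- Cramer's rule for the system `rho_mul_S`, `rho_mul_S_pred`, whose determinant is Δ. -/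
theorem Delta_mul_P_succ (n : ℕ) : J.Delta (n + 2) * J.P (n + 2) =
    J.rho * (J.D2 (n + 2) * J.S (n + 2) - J.B2 (n + 2) * J.S (n + 1)) := by
  rw [Delta]
  linear_combination -J.D2 (n + 2) * J.rho_mul_S (n + 1) + J.B2 (n + 2) * J.rho_mul_S_pred n

theorem Delta_mul_P (n : ℕ) : J.Delta (n + 2) * J.P (n + 1) =
    J.rho * (J.A2 (n + 2) * J.S (n + 1) - J.C2 (n + 2) * J.S (n + 2)) := by
  rw [Delta]
  linear_combination J.C2 (n + 2) * J.rho_mul_S (n + 1) - J.A2 (n + 2) * J.rho_mul_S_pred n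

theorem Delta_eq (n : ℕ) : J.Delta (n + 2) = J.rho * J.delta (n + 2) := by
  have hdvd : J.rho ∣ J.Delta (n + 2) := by
    -- ρ divides both Δ P_{n+2} and Δ P_{n+1}; a Bézout combination of the two is Δ itself.
    obtain ⟨u, v, h⟩ := J.isMonicOrthSeq.isCoprime_succ (n + 1)
    refine ⟨u * (J.D2 (n + 2) * J.S (n + 2) - J.B2 (n + 2) * J.S (n + 1)) +
      v * (J.A2 (n + 2) * J.S (n + 1) - J.C2 (n + 2) * J.S (n + 2)), ?_⟩
    linear_combination u * J.Delta_mul_P_succ n + v * J.Delta_mul_P n - J.Delta (n + 2) * h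
  have h := modByMonic_add_div (J.Delta (n + 2)) J.rho
  rw [(modByMonic_eq_zero_iff_dvd J.rho_monic).2 hdvd, zero_add] at h
  exact h.symm

theorem ladder_lower (n : ℕ) : J.q2 (n + 2) * J.S (n + 2) +
    J.q0 (n + 2) * derivative (J.S (n + 2)) = J.q1 (n + 2) * J.S (n + 1) := by
  -- After multiplying the derivative formula by Δ, every term carries a factor ρ: the P-terms by
  -- Cramer's rule, the terms from (ρ S)' because Δ = ρ δ or explicitly.
  apply mul_left_cancel₀ J.rho_monic.ne_zero
  have h := J.derivative_rho_mul_S (n + 1)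
  rw [derivative_mul] at h
  rw [q2, q0, q1]
  linear_combination J.Delta (n + 2) * h + J.A3 (n + 2) * J.Delta_mul_P_succ n +
    J.B3 (n + 2) * J.Delta_mul_P n -
    (1 - X ^ 2) * derivative J.rho * J.S (n + 2) * J.Delta_eq n

theorem ladder_raise (n : ℕ) : J.q3 (n + 2) * J.S (n + 1) +
    J.q0 (n + 2) * derivative (J.S (n + 1)) = J.q4 (n + 2) * J.S (n + 2) := by
  apply mul_left_cancel₀ J.rho_monic.ne_zero
  have h := J.derivative_rho_mul_S_pred n
  rw [derivative_mul] at h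
  rw [q3, q0, q4]
  linear_combination J.Delta (n + 2) * h + J.C3 (n + 2) * J.Delta_mul_P_succ n +
    J.D3 (n + 2) * J.Delta_mul_P n -
    (1 - X ^ 2) * derivative J.rho * J.S (n + 1) * J.Delta_eq n

theorem toRat_div_add_div {p q r f g h : ℝ[X]} (hr : r ≠ 0) (heq : p * f + q * g = r * h) :
    toRat p / toRat r * toRat f + toRat q / toRat r * toRat g = toRat h := by
  have hr' : toRat r ≠ 0 := RatFunc.algebraMap_ne_zero hr
  have heq' := congrArg toRat heq
  simp only [toRat, map_add, map_mul] at heq'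
  field_simp
  exact heq'

end JacobiSobolev

theorem mainTheorem2 (J : JacobiSobolev) (n : ℕ) (hn : 2 ≤ n) :
    -- the division that defines `δ_n` is exact
    J.Delta n = J.rho * J.delta n ∧
    -- the exact degrees; in particular `q_{1,n}` and `q_{4,n}` are not zero
    (J.q0 n).degree = ((2 * J.d + 2 : ℕ) : WithBot ℕ) ∧
    (J.q1 n).degree = ((2 * J.d : ℕ) : WithBot ℕ) ∧
    (J.q2 n).degree = ((2 * J.d + 1 : ℕ) : WithBot ℕ) ∧
    (J.q3 n).degree = ((2 * J.d + 1 : ℕ) : WithBot ℕ) ∧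
    (J.q4 n).degree = ((2 * J.d : ℕ) : WithBot ℕ) ∧
    -- the ladder equations, as identities of rational functions
    J.A4 n * JacobiSobolev.toRat (J.S n) +
        J.B4 n * JacobiSobolev.toRat (Polynomial.derivative (J.S n)) =
      JacobiSobolev.toRat (J.S (n - 1)) ∧
    J.C4 n * JacobiSobolev.toRat (J.S (n - 1)) +
        J.D4 n * JacobiSobolev.toRat (Polynomial.derivative (J.S (n - 1))) =
      JacobiSobolev.toRat (J.S n) := by
  obtain ⟨n, rfl⟩ : ∃ m, n = m + 2 := ⟨n - 2, by omega⟩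
  have h1 := J.q1_degree (n + 1)
  have h4 := J.q4_degree n
  refine ⟨J.Delta_eq n, J.q0_degree n, h1, J.q2_degree (J.Delta_eq n), J.q3_degree (J.Delta_eq n),
    h4, JacobiSobolev.toRat_div_add_div ?_ (J.ladder_lower n),
    JacobiSobolev.toRat_div_add_div ?_ (J.ladder_raise n)⟩
  · exact ne_zero_of_degree_gt (n := ⊥) (by rw [h1]; exact WithBot.bot_lt_coe _)
  · exact ne_zero_of_degree_gt (n := ⊥) (by rw [h4]; exact WithBot.bot_lt_coe _)
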